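/- Let $g, n \ge 1$ be integers and let $w = (w_1, \dots, w_n) \in (\mathbb{Q} \cap (0,1])^n$. A weighted $n$-marked graph is a triple $\mathbf{G} = (G, m, h)$, where $G$ is a finite connected graph (loops and parallel edges allowed), $m : \{1, \dots, n\} \to V(G)$ and $h : V(G) \to \mathbb{Z}_{\ge 0}$ are functions. It is $w$-stable if $2h(v) - 2 + \operatorname{val}(v) + \sum_{i \in m^{-1}(v)} w_i > 0$ for every vertex $v$ (a loop counts twice in the valence), and its genus is $|E(G)| - |V(G)| + 1 + \sum_v h(v)$. Contracting an edge removes it and either identifies its endpoints, adding their weights (if it is not a loop), or increases the weight of its base vertex by one (if it is a loop). A symmetric $\Delta$-complex is a contravariant functor $X$ to sets from the category of the finite sets $[p] = \{0, \dots, p\}$, $p \ge -1$ (with $[-1] = \varnothing$), and all injections. Its geometric realization is the topological quotient $|X| = \bigl(\coprod_{p \ge 0} X([p]) \times \sigma^p\bigr)/\!\sim$, where $\sigma^p$ is the standard $p$-simplex and $\sim$ is generated by $(X(\iota)(x), a) \sim (x, \iota_* a)$ for all injections $\iota : [p] \to [q]$, $x \in X([q])$, $a \in \sigma^p$. Let $\Delta_{g,w}$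 be the symmetric $\Delta$-complex for which $\Delta_{g,w}([p])$ is the set of isomorphism classes of pairs $(\mathbf{G}, \tau)$, with $\mathbf{G}$ a $w$-stable weighted $n$-marked graph of genus $g$ and $\tau : E(\mathbf{G}) \to [p]$ a bijection; an injection $\iota : [p] \to [q]$ sends $[\mathbf{G}, \tau]$ to the class of the graph obtained from $\mathbf{G}$ by contracting all edges whose label is not in $\iota([p])$, each remaining edge $e$ being labelled by $\iota^{-1}(\tau(e))$. Let $\Delta^{\mathrm{lw}}_{g,w} \subseteq \Delta_{g,w}$ be the subcomplex of all classes $[\mathbf{G}, \tau]$ such that $\mathbf{G}$ has a loop or a vertex of positive weight. Then (the geometric realization of) $\Delta^{\mathrm{lw}}_{g,w}$ is contractible. -/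

import Mathlib

open CategoryTheory
open scoped BigOperators

namespace TropicalHassett

/-! ### Symmetric Delta-complexes and their geometric realization -/

/-- The category with one object for each finite set `{0, …, p}` and for the empty set; the object
with `card = p + 1` stands for `{0, …, p}`. The morphisms are all injections. -/
structure FinInj where
  card : ℕ

instance : Category FinInj where
  Hom a b := Fin a.card ↪ Fin b.card
  id a := Function.Embedding.refl _
  comp f g := f.trans g

/-- The injection underlying a morphism. -/
def FinInj.toEmbedding {a b : FinInj} (ι : a ⟶ b) : Fin a.card ↪ Fin b.card := ι

/-- The object `[p] = {0, …, p}`, for `p ≥ 0`. -/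
def FinInj.std (p : ℕ) : FinInj := ⟨p + 1⟩

/-- A symmetric Delta-complex: a contravariant functor from finite sets and injections to sets. -/
abbrev SymmDeltaComplex := FinInjᵒᵖ ⥤ Type 1

/-- The generating relation of the geometric realization of `X`: `(X(ι)(x), a) ∼ (x, ι_* a)` for an
injection `ι : [p] → [q]`, a simplex `x ∈ X([q])` and a point `a` of the standard `p`-simplex. -/
inductive RealizationRel (X : SymmDeltaComplex) :
    (Σ x : (Σ p : ℕ, X.obj (Opposite.op (FinInj.std p))), stdSimplex ℝ (Fin (x.1 + 1))) →
    (Σ x : (Σ p : ℕ, X.obj (Opposite.op (FinInj.std p))), stdSimplex ℝ (Fin (x.1 + 1))) → Prop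
  | glue {p q : ℕ} (ι : FinInj.std p ⟶ FinInj.std q) (x : X.obj (Opposite.op (FinInj.std q)))
      (a : stdSimplex ℝ (Fin (p + 1))) :
      RealizationRel X ⟨⟨p, X.map ι.op x⟩, a⟩
        ⟨⟨q, x⟩, stdSimplex.map (FinInj.toEmbedding ι) a⟩

/-- The geometric realization: the quotient of the disjoint union over `p ≥ 0` and `x ∈ X([p])` of
standard `p`-simplices by the equivalence relation that `RealizationRel` generates. -/
def Realization (X : SymmDeltaComplex) : Type 1 := Quot (RealizationRel X)

/-- The quotient topology of the disjoint union topology. -/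
instance (X : SymmDeltaComplex) : TopologicalSpace (Realization X) :=
  inferInstanceAs (TopologicalSpace (Quot (RealizationRel X)))

/-! ### Weighted marked graphs -/

/-- A finite graph (loops and parallel edges allowed) with `n` markings and natural number weights
on the vertices. Connectedness is imposed later. -/
structure MarkedGraph (n : ℕ) where
  V : Type
  E : Type
  [finV : Fintype V]
  [finE : Fintype E]
  ends : E → Sym2 V
  mark : Fin n → V
  weight : V → ℕ

attribute [instance] MarkedGraph.finV MarkedGraph.finE

section
open scoped Classical
set_option linter.unusedSimpArgs false

variable {n : ℕ}

namespace MarkedGraph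

/-- Two vertices are joined through `S` if there is a path of edges of `S` between them. -/
def joined (G : MarkedGraph n) (S : Set G.E) : Setoid G.V :=
  Relation.EqvGen.setoid fun u v => ∃ e ∈ S, G.ends e = s(u, v)

def IsConnected (G : MarkedGraph n) : Prop :=
  Nonempty G.V ∧ ∀ u v, G.joined Set.univ u v

/-- The number of half edges at `v`; a loop counts twice. -/
noncomputable def val (G : MarkedGraph n) (v : G.V) : ℕ :=
  ∑ e, (G.ends e).toMultiset.count v

/-- The genus `|E| - |V| + 1 + ∑ v, h(v)` (of a connected graph). -/
def genus (G : MarkedGraph n) : ℤ :=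
  ((Fintype.card G.E : ℤ) - Fintype.card G.V + 1) + ∑ v, (G.weight v : ℤ)

/-- `w`-stability. -/
def IsStable (G : MarkedGraph n) (w : Fin n → ℚ) : Prop :=
  ∀ v, 0 < 2 * (G.weight v : ℚ) - 2 + G.val v + ∑ i with G.mark i = v, w i

/-- `G` is an object of the category of connected `w`-stable weighted `n`-marked graphs of
genus `g`. -/
def InGamma (g : ℕ) (w : Fin n → ℚ) (G : MarkedGraph n) : Prop :=
  G.IsConnected ∧ G.IsStable w ∧ G.genus = g

/-- `G` has a loop or a vertex of positive weight. -/
def HasLoopOrWeight (G : MarkedGraph n) : Prop :=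
  (∃ e, (G.ends e).IsDiag) ∨ ∃ v, 0 < G.weight v

/-- The vertices that a map sends to `c`. -/
noncomputable def vertsOver (G : MarkedGraph n) {W : Type} (f : G.V → W) (c : W) : Finset G.V :=
  {v | f v = c}

/-- The edges in `S` whose endpoints are both sent to `c`. -/
noncomputable def edgesOver (G : MarkedGraph n) (S : Set G.E) {W : Type} (f : G.V → W) (c : W) :
    Finset G.E :=
  {e | e ∈ S ∧ (G.ends e).map f = s(c, c)}

@[simp]
theorem mem_vertsOver (G : MarkedGraph n) {W : Type} {f : G.V → W} {c : W} {v : G.V} :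
    v ∈ G.vertsOver f c ↔ f v = c := by simp [vertsOver]

@[simp]
theorem mem_edgesOver (G : MarkedGraph n) {S : Set G.E} {W : Type} {f : G.V → W} {c : W}
    {e : G.E} : e ∈ G.edgesOver S f c ↔ e ∈ S ∧ (G.ends e).map f = s(c, c) := by
  simp [edgesOver]

/-- The graph obtained by contracting all edges that are not in `K`. The connected components of
the subgraph formed by the contracted edges become vertices, and the weight of such a vertex is the
total weight of the component plus its first Betti number (number of edges plus one minus number
of vertices). For one contracted edge: a non-loop has its endpoints identified and their weights
added, and a loop adds one to the weight of its vertex. -/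
noncomputable def contract (G : MarkedGraph n) (K : Set G.E) : MarkedGraph n where
  V := Quotient (G.joined Kᶜ)
  E := K
  finV := Fintype.ofFinite _
  finE := Fintype.ofFinite _
  ends e := (G.ends e).map (Quotient.mk _)
  mark i := Quotient.mk _ (G.mark i)
  weight c :=
    ∑ v ∈ G.vertsOver (Quotient.mk (G.joined Kᶜ)) c, G.weight v +
      ((G.edgesOver Kᶜ (Quotient.mk (G.joined Kᶜ)) c).card + 1 -
        (G.vertsOver (Quotient.mk (G.joined Kᶜ)) c).card)

/-- The pair of maps (on vertices, forwards; on edges, backwards) exhibits `H` as obtained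
from `G` by contracting the edges outside the image of `k`. -/
structure IsContraction (G H : MarkedGraph n) (f : G.V → H.V) (k : H.E → G.E) : Prop where
  surj : Function.Surjective f
  inj : Function.Injective k
  ends : ∀ e, H.ends e = (G.ends (k e)).map f
  mark : ∀ i, H.mark i = f (G.mark i)
  fiber : ∀ u v, f u = f v ↔ G.joined (Set.range k)ᶜ u v
  weight : ∀ c, H.weight c + (G.vertsOver f c).card =
    ∑ v ∈ G.vertsOver f c, G.weight v + (G.edgesOver (Set.range k)ᶜ f c).card + 1

end MarkedGraph

open MarkedGraph

theorem joined_mono (G : MarkedGraph n) {S T : Set G.E} (h : S ⊆ T) {u v : G.V}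
    (huv : G.joined S u v) : G.joined T u v := by
  change Relation.EqvGen _ u v at huv
  induction huv with
  | rel x y hxy =>
    obtain ⟨e, he, h'⟩ := hxy
    exact Relation.EqvGen.rel _ _ ⟨e, h he, h'⟩
  | refl x => exact (G.joined T).refl _
  | symm x y _ ih => exact (G.joined T).symm ih
  | trans x y z _ _ ih1 ih2 => exact (G.joined T).trans ih1 ih2

theorem joined_of_mem (G : MarkedGraph n) {S : Set G.E} {e : G.E} (he : e ∈ S) {u v : G.V}
    (h : G.ends e = s(u, v)) : G.joined S u v :=
  Relation.EqvGen.rel _ _ ⟨e, he, h⟩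

/-- A component of the subgraph with edge set `S` has at least (number of vertices - 1) edges,
not counting loops. -/
theorem card_fiber_le (G : MarkedGraph n) (S : Set G.E) (c : Quotient (G.joined S)) :
    (G.vertsOver (Quotient.mk (G.joined S)) c).card ≤
      ((G.edgesOver S (Quotient.mk (G.joined S)) c).filter fun e => ¬ (G.ends e).IsDiag).card + 1 := by
  let C := {v : G.V // Quotient.mk (G.joined S) v = c}
  let Γ : SimpleGraph C :=
    { Adj := fun u v => u ≠ v ∧ ∃ e ∈ S, G.ends e = s(u.1, v.1)
      symm := ⟨fun u v ⟨h, e, he, h'⟩ => ⟨h.symm, e, he, by rw [h', Sym2.eq_swap]⟩⟩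
      loopless := ⟨fun u h => h.1 rfl⟩ }
  have hreach : ∀ u v : G.V, G.joined S u v → ∀ (hu : Quotient.mk (G.joined S) u = c)
      (hv : Quotient.mk (G.joined S) v = c), Γ.Reachable ⟨u, hu⟩ ⟨v, hv⟩ := by
    intro u v h
    change Relation.EqvGen _ u v at h
    induction h with
    | rel x y hxy =>
      intro hu hv
      by_cases hne : x = y
      · subst hne; exact SimpleGraph.Reachable.refl _
      · obtain ⟨e, he, h'⟩ := hxy
        exact SimpleGraph.Adj.reachable ⟨fun h => hne (congrArg Subtype.val h), e, he, h'⟩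
    | refl x => intro hu hv; exact SimpleGraph.Reachable.refl _
    | symm x y _ ih => intro hu hv; exact (ih hv hu).symm
    | trans x y z hxy hyz ih1 ih2 =>
      intro hu hv
      have hy : Quotient.mk (G.joined S) y = c := by
        rw [← hu]; exact (Quotient.sound (s := G.joined S) hxy).symm
      exact (ih1 hu hy).trans (ih2 hy hv)
  obtain ⟨r, hr⟩ := Quotient.exists_rep c
  have : Nonempty C := ⟨⟨r, hr⟩⟩
  have hconn : Γ.Connected :=
    { preconnected := fun u v => hreach _ _ (Quotient.exact (u.2.trans v.2.symm)) u.2 v.2 }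
  have h1 := hconn.card_vert_le_card_edgeSet_add_one
  have h2 : Nat.card C = (G.vertsOver (Quotient.mk (G.joined S)) c).card := by
    rw [Nat.card_eq_fintype_card]
    exact Fintype.card_of_subtype _ fun v => G.mem_vertsOver
  have h3 : Nat.card Γ.edgeSet ≤
      ((G.edgesOver S (Quotient.mk (G.joined S)) c).filter fun e => ¬ (G.ends e).IsDiag).card := by
    have hex : ∀ z : Γ.edgeSet, ∃ e : {e : G.E // (e ∈ S ∧
        (G.ends e).map (Quotient.mk (G.joined S)) = s(c, c)) ∧ ¬ (G.ends e).IsDiag},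
        G.ends e.1 = z.1.map Subtype.val := by
      rintro ⟨z, hz⟩
      induction z with
      | h u v =>
        obtain ⟨hne, e, he, h'⟩ := hz
        refine ⟨⟨e, ⟨he, ?_⟩, ?_⟩, ?_⟩
        · rw [h', Sym2.map_mk, u.2, v.2]
        · rw [h', Sym2.mk_isDiag_iff]; exact fun h => hne (Subtype.ext h)
        · exact h'
    choose φ hφ using hex
    have hinj : Function.Injective φ := by
      intro z z' h
      have := (hφ z).symm.trans ((congrArg (fun e => G.ends e.1) h).trans (hφ z'))
      exact Subtype.ext (Sym2.map.injective Subtype.val_injective this)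
    have := Nat.card_le_card_of_injective φ hinj
    refine this.trans (le_of_eq ?_)
    rw [Nat.card_eq_fintype_card]
    exact Fintype.card_of_subtype _ fun e => by simp
  omega

theorem contract_isContraction (G : MarkedGraph n) (K : Set G.E) :
    IsContraction G (G.contract K) (Quotient.mk _) (Subtype.val) where
  surj := Quotient.exists_rep
  inj := Subtype.val_injective
  ends e := rfl
  mark i := rfl
  fiber u v := by
    have hr : Set.range (Subtype.val : K → G.E) = K := Subtype.range_coe
    change Quotient.mk (G.joined Kᶜ) u = Quotient.mk (G.joined Kᶜ) v ↔
      G.joined (Set.range (Subtype.val : K → G.E))ᶜ u v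
    rw [hr]
    exact Quotient.eq
  weight c := by
    have hr : Set.range (Subtype.val : K → G.E) = K := Subtype.range_coe
    have h := (card_fiber_le G Kᶜ c).trans
      (Nat.add_le_add_right (Finset.card_le_card (Finset.filter_subset _ _)) 1)
    change (∑ v ∈ G.vertsOver (Quotient.mk (G.joined Kᶜ)) c, G.weight v +
      ((G.edgesOver Kᶜ (Quotient.mk (G.joined Kᶜ)) c).card + 1 -
        (G.vertsOver (Quotient.mk (G.joined Kᶜ)) c).card)) +
        (G.vertsOver (Quotient.mk (G.joined Kᶜ)) c).card =
      ∑ v ∈ G.vertsOver (Quotient.mk (G.joined Kᶜ)) c, G.weight v +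
      (G.edgesOver (Set.range (Subtype.val : K → G.E))ᶜ (Quotient.mk (G.joined Kᶜ)) c).card + 1
    rw [hr]
    omega

namespace MarkedGraph.IsContraction

variable {G H L : MarkedGraph n} {f : G.V → H.V} {k : H.E → G.E}

/-- A contracted edge is mapped to a single vertex. -/
theorem map_ends (h : IsContraction G H f k) {e : G.E} (he : e ∉ Set.range k) :
    ∃ c, (G.ends e).map f = s(c, c) := by
  obtain ⟨⟨u, v⟩, huv⟩ := Quot.exists_rep (G.ends e)
  have huv : G.ends e = s(u, v) := huv.symm
  refine ⟨f u, ?_⟩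
  rw [huv, Sym2.map_mk, (h.fiber u v).2 (joined_of_mem G he huv)]

/-- Paths upstairs map to paths downstairs. -/
theorem joined_map (h : IsContraction G H f k) {S : Set G.E} {T : Set H.E}
    (hST : ∀ e, k e ∈ S → e ∈ T) {u v : G.V} (huv : G.joined S u v) : H.joined T (f u) (f v) := by
  change Relation.EqvGen _ u v at huv
  induction huv with
  | rel x y hxy =>
    obtain ⟨e, he, h'⟩ := hxy
    by_cases hk : e ∈ Set.range k
    · obtain ⟨e, rfl⟩ := hk
      exact joined_of_mem H (hST e he) (by rw [h.ends, h', Sym2.map_mk])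
    · rw [(h.fiber x y).2 (joined_of_mem G hk h')]
  | refl x => exact (H.joined T).refl _
  | symm x y _ ih => exact (H.joined T).symm ih
  | trans x y z _ _ ih1 ih2 => exact (H.joined T).trans ih1 ih2

/-- Paths downstairs lift. -/
theorem joined_lift (h : IsContraction G H f k) {S : Set G.E} {T : Set H.E}
    (hS : (Set.range k)ᶜ ⊆ S) (hST : ∀ e ∈ T, k e ∈ S) {a b : H.V} (hab : H.joined T a b) :
    ∀ u v, f u = a → f v = b → G.joined S u v := by
  have hf : ∀ u v, f u = f v → G.joined S u v := fun u v huv =>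
    joined_mono G hS ((h.fiber u v).1 huv)
  change Relation.EqvGen _ a b at hab
  induction hab with
  | rel a b hab =>
    obtain ⟨e, he, h'⟩ := hab
    rintro u v rfl rfl
    obtain ⟨⟨x, y⟩, hxy⟩ := Quot.exists_rep (G.ends (k e))
    have hxy : G.ends (k e) = s(x, y) := hxy.symm
    have hj := joined_of_mem G (hST e he) hxy
    rw [h.ends, hxy, Sym2.map_mk, Sym2.eq_iff] at h'
    rcases h' with ⟨h1, h2⟩ | ⟨h1, h2⟩
    · exact (G.joined S).trans (hf _ _ h1.symm) ((G.joined S).trans hj (hf _ _ h2))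
    · exact (G.joined S).trans (hf _ _ h2.symm)
        ((G.joined S).trans ((G.joined S).symm hj) (hf _ _ h1))
  | refl a => rintro u v rfl h2; exact hf _ _ h2.symm
  | symm a b _ ih => intro u v hu hv; exact (G.joined S).symm (ih v u hv hu)
  | trans a b c _ _ ih1 ih2 =>
    intro u v hu hv
    obtain ⟨y, hy⟩ := h.surj b
    exact (G.joined S).trans (ih1 u y hu hy) (ih2 y v hy hv)

theorem comp {f' : H.V → L.V} {k' : L.E → H.E} (h : IsContraction G H f k)
    (h' : IsContraction H L f' k') : IsContraction G L (f' ∘ f) (k ∘ k') where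
  surj := h'.surj.comp h.surj
  inj := h.inj.comp h'.inj
  ends e := by rw [h'.ends, h.ends, Sym2.map_map, Function.comp_apply]
  mark i := by rw [h'.mark, h.mark]; rfl
  fiber u v := by
    rw [Function.comp_apply, Function.comp_apply, h'.fiber]
    constructor
    · intro hj
      refine h.joined_lift ?_ ?_ hj u v rfl rfl
      · rintro e he ⟨x, rfl⟩; exact he ⟨_, rfl⟩
      · rintro e he ⟨x, hx⟩; exact he ⟨x, h.inj hx⟩
    · intro hj
      refine h.joined_map ?_ hj
      rintro e he ⟨x, rfl⟩; exact he ⟨x, rfl⟩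
  weight c := by
    have e1 : (G.vertsOver (f' ∘ f) c).card =
        ∑ a ∈ H.vertsOver f' c, (G.vertsOver f a).card := by
      rw [Finset.card_eq_sum_card_fiberwise (f := f) (t := H.vertsOver f' c)
        (by intro v hv; simpa using hv)]
      refine Finset.sum_congr rfl fun a ha => ?_
      congr 1; ext v
      simp only [mem_vertsOver, mem_edgesOver, Set.mem_compl_iff, Finset.mem_filter, Finset.mem_univ, true_and] at ha ⊢
      constructor
      · exact fun h => h.2
      · rintro rfl; exact ⟨ha, rfl⟩
    have e2 : ∑ v ∈ G.vertsOver (f' ∘ f) c, G.weight v =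
        ∑ a ∈ H.vertsOver f' c, ∑ v ∈ G.vertsOver f a, G.weight v := by
      rw [← Finset.sum_fiberwise_of_maps_to (g := f) (t := H.vertsOver f' c)
        (by intro v hv; simpa using hv)]
      refine Finset.sum_congr rfl fun a ha => Finset.sum_congr ?_ fun _ _ => rfl
      ext v
      simp only [mem_vertsOver, mem_edgesOver, Set.mem_compl_iff, Finset.mem_filter, Finset.mem_univ, true_and] at ha ⊢
      constructor
      · exact fun h => h.2
      · rintro rfl; exact ⟨ha, rfl⟩
    have e3 : (G.edgesOver (Set.range (k ∘ k'))ᶜ (f' ∘ f) c).card =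
        (H.edgesOver (Set.range k')ᶜ f' c).card +
        ∑ a ∈ H.vertsOver f' c, (G.edgesOver (Set.range k)ᶜ f a).card := by
      rw [← Finset.card_image_of_injective
        (H.edgesOver (Set.range k')ᶜ f' c) h.inj,
        ← Finset.card_biUnion, ← Finset.card_union_of_disjoint]
      · congr 1; ext e
        simp only [mem_vertsOver, mem_edgesOver, Set.mem_compl_iff, Finset.mem_filter, Finset.mem_univ, true_and, Finset.mem_union,
          Finset.mem_image, Finset.mem_biUnion]
        constructor
        · rintro ⟨h1, h2⟩
          by_cases hk : e ∈ Set.range k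
          · obtain ⟨x, rfl⟩ := hk
            refine Or.inl ⟨x, ⟨?_, ?_⟩, rfl⟩
            · rintro ⟨y, rfl⟩; exact h1 ⟨y, rfl⟩
            · rw [h.ends, Sym2.map_map]; exact h2
          · obtain ⟨a, ha⟩ := h.map_ends hk
            refine Or.inr ⟨a, ?_, hk, ha⟩
            rw [← Sym2.map_map, ha, Sym2.map_mk, Sym2.eq_iff] at h2
            rcases h2 with h2 | h2 <;> exact h2.1
        · rintro (⟨x, ⟨h1, h2⟩, rfl⟩ | ⟨a, ha, h1, h2⟩)
          · refine ⟨?_, ?_⟩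
            · rintro ⟨y, hy⟩; exact h1 ⟨y, h.inj hy⟩
            · rw [h.ends, Sym2.map_map] at h2; exact h2
          · refine ⟨?_, ?_⟩
            · rintro ⟨y, rfl⟩; exact h1 ⟨_, rfl⟩
            · rw [← Sym2.map_map, h2, Sym2.map_mk, ha]
      · rw [Finset.disjoint_left]
        intro e he he'
        simp only [mem_vertsOver, mem_edgesOver, Set.mem_compl_iff, Finset.mem_filter, Finset.mem_univ, true_and, Finset.mem_image,
          Finset.mem_biUnion] at he he'
        obtain ⟨x, _, rfl⟩ := he
        obtain ⟨_, _, h1, _⟩ := he'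
        exact h1 ⟨x, rfl⟩
      · intro a _ b _ hab
        rw [Function.onFun, Finset.disjoint_left]
        intro e he he'
        simp only [mem_vertsOver, mem_edgesOver, Set.mem_compl_iff, Finset.mem_filter, Finset.mem_univ, true_and] at he he'
        have := he.2.symm.trans he'.2
        rw [Sym2.eq_iff] at this
        rcases this with this | this <;> exact hab this.1
    have e4 : (∑ a ∈ H.vertsOver f' c, H.weight a) + ∑ a ∈ H.vertsOver f' c, (G.vertsOver f a).card =
        (∑ a ∈ H.vertsOver f' c, ∑ v ∈ G.vertsOver f a, G.weight v) +
        (∑ a ∈ H.vertsOver f' c, (G.edgesOver (Set.range k)ᶜ f a).card) +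
        (H.vertsOver f' c).card := by
      rw [← Finset.sum_add_distrib, Finset.card_eq_sum_ones, ← Finset.sum_add_distrib,
        ← Finset.sum_add_distrib]
      exact Finset.sum_congr rfl fun a _ => h.weight a
    have e5 := h'.weight c
    rw [e1, e2, e3]
    omega

theorem isConnected (h : IsContraction G H f k) (hG : G.IsConnected) : H.IsConnected := by
  refine ⟨hG.1.map f, fun a b => ?_⟩
  obtain ⟨u, rfl⟩ := h.surj a
  obtain ⟨v, rfl⟩ := h.surj b
  exact h.joined_map (fun _ _ => trivial) (hG.2 u v)

theorem card_edges (h : IsContraction G H f k) :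
    Fintype.card G.E = Fintype.card H.E +
      ∑ c, (G.edgesOver (Set.range k)ᶜ f c).card := by
  rw [← Finset.card_biUnion, ← Finset.card_univ (α := H.E),
    ← Finset.card_image_of_injective Finset.univ h.inj, ← Finset.card_union_of_disjoint,
    ← Finset.card_univ]
  · congr 1; ext e
    simp only [mem_vertsOver, mem_edgesOver, Set.mem_compl_iff, Finset.mem_filter, Finset.mem_univ, true_and, Finset.mem_union,
      Finset.mem_image, Finset.mem_biUnion, true_iff]
    by_cases hk : e ∈ Set.range k
    · exact Or.inl hk
    · obtain ⟨a, ha⟩ := h.map_ends hk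
      exact Or.inr ⟨a, hk, ha⟩
  · rw [Finset.disjoint_left]
    intro e he he'
    simp only [mem_vertsOver, mem_edgesOver, Set.mem_compl_iff, Finset.mem_filter, Finset.mem_univ, true_and, Finset.mem_image,
      Finset.mem_biUnion] at he he'
    obtain ⟨_, h1, _⟩ := he'
    exact h1 he
  · intro a _ b _ hab
    rw [Function.onFun, Finset.disjoint_left]
    intro e he he'
    simp only [mem_vertsOver, mem_edgesOver, Set.mem_compl_iff, Finset.mem_filter, Finset.mem_univ, true_and] at he he'
    have := he.2.symm.trans he'.2
    rw [Sym2.eq_iff] at this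
    rcases this with this | this <;> exact hab this.1

theorem genus_eq (h : IsContraction G H f k) : H.genus = G.genus := by
  have h1 := h.card_edges
  have h2 : Fintype.card G.V = ∑ c, (G.vertsOver f c).card := by
    rw [← Finset.card_univ, Finset.card_eq_sum_card_fiberwise (f := f) (t := Finset.univ)
      (fun _ _ => Finset.mem_coe.2 (Finset.mem_univ _))]
    rfl
  have h3 : ∑ v, G.weight v = ∑ c, ∑ v ∈ G.vertsOver f c, G.weight v :=
    (Finset.sum_fiberwise _ _ _).symm
  have h4 : (∑ c, H.weight c) + ∑ c, (G.vertsOver f c).card =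
      (∑ c, ∑ v ∈ G.vertsOver f c, G.weight v) +
      (∑ c, (G.edgesOver (Set.range k)ᶜ f c).card) +
      Fintype.card H.V := by
    rw [← Finset.card_univ (α := H.V), Finset.card_eq_sum_ones, ← Finset.sum_add_distrib,
      ← Finset.sum_add_distrib, ← Finset.sum_add_distrib]
    exact Finset.sum_congr rfl fun a _ => h.weight a
  unfold genus
  rw [← Nat.cast_sum, ← Nat.cast_sum]
  omega

theorem count_map {α β : Type} [Fintype α] (f : α → β) (z : Sym2 α) (c : β) :
    ∑ v with f v = c, z.toMultiset.count v = (z.map f).toMultiset.count c := by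
  induction z with
  | h x y =>
    have : ∀ (γ : Type) (a b t : γ), (Sym2.toMultiset s(a, b)).count t =
        (if t = a then 1 else 0) + (if t = b then 1 else 0) := by
      intro γ a b t
      change Multiset.count t (a ::ₘ b ::ₘ 0) = _
      rw [Multiset.count_cons, Multiset.count_cons, Multiset.count_zero]
      omega
    simp only [this, Sym2.map_mk, Finset.sum_add_distrib, Finset.sum_ite_eq', Finset.mem_filter,
      Finset.mem_univ, true_and, eq_comm (a := c)]

theorem val_eq (h : IsContraction G H f k) (c : H.V) :
    ∑ v ∈ G.vertsOver f c, G.val v = H.val c +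
      2 * (G.edgesOver (Set.range k)ᶜ f c).card := by
  unfold val
  rw [Finset.sum_comm]
  have hc : ∀ z : Sym2 G.V, ∑ v ∈ G.vertsOver f c, z.toMultiset.count v =
      (z.map f).toMultiset.count c := fun z => count_map f z c
  simp only [hc]
  rw [← Finset.sum_filter_add_sum_filter_not Finset.univ (fun e => e ∈ Set.range k)]
  congr 1
  · rw [show (Finset.univ.filter fun e => e ∈ Set.range k) = Finset.univ.image k by
      ext e; simp, Finset.sum_image (fun _ _ _ _ h' => h.inj h')]
    exact Finset.sum_congr rfl fun e _ => by rw [h.ends]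
  · have h2 : 2 * (G.edgesOver (Set.range k)ᶜ f c).card =
        ∑ e with e ∉ Set.range k, if (G.ends e).map f = s(c, c) then 2 else 0 := by
      rw [mul_comm, ← smul_eq_mul, ← Finset.sum_const, ← Finset.sum_filter]
      exact Finset.sum_congr (by ext e; simp) fun _ _ => rfl
    rw [h2]
    refine Finset.sum_congr rfl fun e he => ?_
    obtain ⟨a, ha⟩ := h.map_ends (Finset.mem_filter.1 he).2
    rw [ha]
    change Multiset.count c (a ::ₘ a ::ₘ 0) = _
    rw [Multiset.count_cons, Multiset.count_cons, Multiset.count_zero]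
    by_cases hca : c = a
    · subst hca; simp
    · rw [if_neg hca, if_neg]
      rw [Sym2.eq_iff]
      rintro (h' | h') <;> exact hca h'.1.symm

theorem isStable (h : IsContraction G H f k) {w : Fin n → ℚ} (hG : G.IsStable w) :
    H.IsStable w := by
  intro c
  have h0 : 0 < ∑ v ∈ G.vertsOver f c,
      (2 * (G.weight v : ℚ) - 2 + G.val v + ∑ i with G.mark i = v, w i) := by
    refine Finset.sum_pos (fun v _ => hG v) ?_
    obtain ⟨v, hv⟩ := h.surj c
    exact ⟨v, by simpa using hv⟩
  have h1 : ∑ v ∈ G.vertsOver f c, ∑ i with G.mark i = v, w i = ∑ i with H.mark i = c, w i := by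
    rw [← Finset.sum_fiberwise_of_maps_to (s := {i | H.mark i = c}) (g := G.mark)
      (t := G.vertsOver f c) (by intro i hi; simpa [h.mark] using hi)]
    refine Finset.sum_congr rfl fun v hv => Finset.sum_congr ?_ fun _ _ => rfl
    ext i
    simp only [mem_vertsOver, mem_edgesOver, Set.mem_compl_iff, Finset.mem_filter, Finset.mem_univ, true_and] at hv ⊢
    rw [h.mark]
    constructor
    · rintro rfl; exact ⟨hv, rfl⟩
    · exact fun h => h.2
  have h2 : ((∑ v ∈ G.vertsOver f c, G.val v : ℕ) : ℚ) = _ := congrArg Nat.cast (h.val_eq c)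
  have h3 : ((_ : ℕ) : ℚ) = _ := congrArg Nat.cast (h.weight c)
  push_cast at h2 h3
  rw [Finset.sum_add_distrib, h1, Finset.sum_add_distrib, h2, Finset.sum_sub_distrib,
    ← Finset.mul_sum, Finset.sum_const, nsmul_eq_mul] at h0
  linarith

theorem inGamma (h : IsContraction G H f k) {g : ℕ} {w : Fin n → ℚ} (hG : G.InGamma g w) :
    H.InGamma g w :=
  ⟨h.isConnected hG.1, h.isStable hG.2.1, h.genus_eq.trans hG.2.2⟩

end MarkedGraph.IsContraction

/-- Having a loop or a vertex of positive weight is preserved by contraction. -/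
theorem hasLoopOrWeight_contract (G : MarkedGraph n) (K : Set G.E) (hG : G.HasLoopOrWeight) :
    (G.contract K).HasLoopOrWeight := by
  rcases hG with ⟨e, he⟩ | ⟨v, hv⟩
  · by_cases hK : e ∈ K
    · exact Or.inl ⟨⟨e, hK⟩, Sym2.IsDiag.map he⟩
    · right
      obtain ⟨⟨x, y⟩, hxy⟩ := Quot.exists_rep (G.ends e)
      have hxy : G.ends e = s(x, y) := hxy.symm
      have he' := he
      rw [hxy, Sym2.mk_isDiag_iff] at he'
      subst he'
      refine ⟨Quotient.mk _ x, ?_⟩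
      have h2 := (card_fiber_le G Kᶜ (Quotient.mk _ x)).trans_lt (Nat.add_lt_add_right
        (Finset.card_lt_card (Finset.filter_ssubset.2
          ⟨e, (G.mem_edgesOver).2 ⟨hK, by rw [hxy, Sym2.map_mk]⟩, fun h => h he⟩)) 1)
      change 0 < _ + (_ - _)
      omega
  · right
    refine ⟨Quotient.mk _ v, ?_⟩
    change 0 < ∑ u ∈ G.vertsOver (Quotient.mk (G.joined Kᶜ)) (Quotient.mk _ v), G.weight u + _
    have : G.weight v ≤
        ∑ u ∈ G.vertsOver (Quotient.mk (G.joined Kᶜ)) (Quotient.mk _ v), G.weight u :=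
      Finset.single_le_sum (f := G.weight) (fun _ _ => Nat.zero_le _) (by simp)
    omega

/-! ### Edge-labelled graphs and the complex of tropical curves -/

/-- A weighted marked graph with `m` edges together with a bijection from its edges to
`{0, …, m - 1}`. -/
structure LabelledGraph (n m : ℕ) where
  graph : MarkedGraph n
  label : graph.E ≃ Fin m

namespace LabelledGraph

variable {m : ℕ}

/-- An isomorphism of weighted marked graphs that is compatible with the edge labellings. -/
structure Iso (x y : LabelledGraph n m) where
  onV : x.graph.V ≃ y.graph.V
  onE : x.graph.E ≃ y.graph.E
  ends : ∀ e, y.graph.ends (onE e) = (x.graph.ends e).map onV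
  mark : ∀ i, y.graph.mark i = onV (x.graph.mark i)
  weight : ∀ v, y.graph.weight (onV v) = x.graph.weight v
  label : ∀ e, y.label (onE e) = x.label e

/-- Contract all edges whose label is not in the image of `ι`, and label a remaining edge with the
preimage under `ι` of its label. -/
noncomputable def restrict {l : ℕ} (x : LabelledGraph n m) (ι : Fin l ↪ Fin m) :
    LabelledGraph n l where
  graph := x.graph.contract {e | x.label e ∈ Set.range ι}
  label := (x.label.subtypeEquiv (fun _ => Iff.rfl)).trans (Equiv.ofInjective ι ι.injective).symm

/-- `y` is obtained from `x` by contraction and relabelling along `ι`. -/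
def ContractsTo {l : ℕ} (ι : Fin l ↪ Fin m) (x : LabelledGraph n m) (y : LabelledGraph n l) :
    Prop :=
  ∃ f k, IsContraction x.graph y.graph f k ∧ ∀ e, x.label (k e) = ι (y.label e)

theorem contractsTo_restrict {l : ℕ} (x : LabelledGraph n m) (ι : Fin l ↪ Fin m) :
    ContractsTo ι x (x.restrict ι) := by
  refine ⟨_, _, contract_isContraction _ _, fun e => ?_⟩
  exact (Equiv.apply_ofInjective_symm ι.injective ⟨x.label e.1, e.2⟩).symm

theorem ContractsTo.trans {l r : ℕ} {ι : Fin l ↪ Fin m} {κ : Fin r ↪ Fin l}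
    {x : LabelledGraph n m} {y : LabelledGraph n l} {z : LabelledGraph n r}
    (h : ContractsTo ι x y) (h' : ContractsTo κ y z) : ContractsTo (κ.trans ι) x z := by
  obtain ⟨f, k, h1, h2⟩ := h
  obtain ⟨f', k', h1', h2'⟩ := h'
  refine ⟨_, _, h1.comp h1', fun e => ?_⟩
  rw [Function.comp_apply, h2, h2']; rfl

theorem Iso.contractsTo {x y : LabelledGraph n m} (φ : Iso x y) :
    ContractsTo (Function.Embedding.refl _) x y := by
  have hr : (Set.range φ.onE.symm)ᶜ = ∅ := by simp
  refine ⟨φ.onV, φ.onE.symm, ⟨φ.onV.surjective, φ.onE.symm.injective, ?_, φ.mark, ?_, ?_⟩, ?_⟩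
  · intro e
    rw [← φ.ends, Equiv.apply_symm_apply]
  · intro u v
    rw [φ.onV.injective.eq_iff, hr]
    constructor
    · rintro rfl; exact (x.graph.joined ∅).refl _
    · intro h
      change Relation.EqvGen _ u v at h
      induction h with
      | rel _ _ h => exact absurd h.choose_spec.1 (by simp)
      | refl _ => rfl
      | symm _ _ _ ih => exact ih.symm
      | trans _ _ _ _ _ ih1 ih2 => exact ih1.trans ih2
  · intro c
    have h1 : x.graph.vertsOver φ.onV c = {φ.onV.symm c} := by
      ext v; simp [Equiv.eq_symm_apply]
    have h2 := φ.weight (φ.onV.symm c)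
    rw [Equiv.apply_symm_apply] at h2
    rw [h1, Finset.card_singleton, Finset.sum_singleton, h2, Finset.card_eq_zero.2]
    ext e; simp
  · intro e
    rw [← φ.label, Equiv.apply_symm_apply]; rfl

theorem ContractsTo.unique {l : ℕ} {ι : Fin l ↪ Fin m} {x : LabelledGraph n m}
    {y z : LabelledGraph n l} (h : ContractsTo ι x y) (h' : ContractsTo ι x z) :
    Nonempty (Iso y z) := by
  obtain ⟨f, k, h1, h2⟩ := h
  obtain ⟨f', k', h1', h2'⟩ := h'
  have hk : ∀ e, k' ((y.label.trans z.label.symm) e) = k e := by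
    intro e
    apply x.label.injective
    rw [h2, h2']; simp
  have hr : Set.range k' = Set.range k := by
    rw [← (y.label.trans z.label.symm).surjective.range_comp k']
    exact congrArg Set.range (funext hk)
  have hff : ∀ u v, f u = f v ↔ f' u = f' v := by
    intro u v; rw [h1.fiber, h1'.fiber, hr]
  let φ : y.graph.V → z.graph.V := fun a => f' (Function.surjInv h1.surj a)
  have hφ : ∀ u, φ (f u) = f' u := fun u => (hff _ _).1 (Function.surjInv_eq h1.surj (f u))
  have hb : Function.Bijective φ := by
    constructor
    · intro a b hab
      obtain ⟨u, rfl⟩ := h1.surj a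
      obtain ⟨v, rfl⟩ := h1.surj b
      rw [hφ, hφ] at hab
      exact (hff u v).2 hab
    · intro c
      obtain ⟨u, rfl⟩ := h1'.surj c
      exact ⟨f u, hφ u⟩
  have hinj : ∀ v c, f' v = φ c ↔ f v = c := by
    intro v c
    obtain ⟨u, rfl⟩ := h1.surj c
    rw [hφ, hff]
  have hcomp : φ ∘ f = f' := funext hφ
  refine ⟨⟨Equiv.ofBijective φ hb, y.label.trans z.label.symm, ?_, ?_, ?_, ?_⟩⟩
  · intro e
    rw [h1'.ends, hk, h1.ends, Sym2.map_map]
    exact congrArg (fun t => Sym2.map t (x.graph.ends (k e))) hcomp.symm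
  · intro i
    rw [h1'.mark, h1.mark]; exact (hφ _).symm
  · intro c
    have e1 := h1.weight c
    have e2 := h1'.weight (φ c)
    have e3 : ∀ e, (x.graph.ends e).map f' = s(φ c, φ c) ↔ (x.graph.ends e).map f = s(c, c) := by
      intro e
      rw [← hcomp, ← Sym2.map_map, ← Sym2.map_mk]
      exact (Sym2.map.injective hb.1).eq_iff
    have e4 : x.graph.vertsOver f' (φ c) = x.graph.vertsOver f c := by
      ext v; simp [hinj]
    have e5 : x.graph.edgesOver (Set.range k)ᶜ f' (φ c) =
        x.graph.edgesOver (Set.range k)ᶜ f c := by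
      ext e; simp [e3]
    rw [hr, e4, e5] at e2
    change z.graph.weight (φ c) = _
    omega
  · intro e; simp

def isoSetoid (g : ℕ) (w : Fin n → ℚ) (m : ℕ) :
    Setoid {x : LabelledGraph n m // x.graph.InGamma g w} where
  r x y := Nonempty (Iso x.1 y.1)
  iseqv :=
    { refl := fun x => ⟨⟨Equiv.refl _, Equiv.refl _, by simp, by simp, by simp, by simp⟩⟩
      symm := by
        rintro x y ⟨φ⟩
        refine ⟨⟨φ.onV.symm, φ.onE.symm, ?_, ?_, ?_, ?_⟩⟩
        · intro e
          rw [← φ.onE.apply_symm_apply e, φ.ends, Sym2.map_map]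
          simp
        · intro i; rw [φ.mark]; simp
        · intro v; rw [← φ.weight]; simp
        · intro e; rw [← φ.label]; simp
      trans := by
        rintro x y z ⟨φ⟩ ⟨ψ⟩
        refine ⟨⟨φ.onV.trans ψ.onV, φ.onE.trans ψ.onE, ?_, ?_, ?_, ?_⟩⟩
        · intro e
          rw [Equiv.trans_apply, ψ.ends, φ.ends, Sym2.map_map]; rfl
        · intro i; rw [ψ.mark, φ.mark]; rfl
        · intro v; rw [Equiv.trans_apply, ψ.weight, φ.weight]
        · intro e; rw [Equiv.trans_apply, ψ.label, φ.label] }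

end LabelledGraph

open LabelledGraph

/-- Isomorphism classes `[G, τ]` of edge-labelled `w`-stable graphs of genus `g` with `m` edges. -/
def Simplices (g : ℕ) (w : Fin n → ℚ) (m : ℕ) : Type 1 := Quotient (isoSetoid g w m)

/-- The face map: `[G, τ]` is sent to the class of the contraction along `ι`. -/
noncomputable def Simplices.map (g : ℕ) (w : Fin n → ℚ) {l m : ℕ} (ι : Fin l ↪ Fin m) :
    Simplices g w m → Simplices g w l :=
  Quotient.map (sa := isoSetoid g w m) (sb := isoSetoid g w l)
    (fun x => ⟨x.1.restrict ι, (contract_isContraction _ _).inGamma x.2⟩)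
    (by
      rintro x y ⟨φ⟩
      exact (contractsTo_restrict x.1 ι).unique
        (φ.contractsTo.trans (contractsTo_restrict y.1 ι)))

/-- The tropical Hassett space as a symmetric Delta-complex. -/
noncomputable def Delta (g : ℕ) (w : Fin n → ℚ) : SymmDeltaComplex where
  obj a := Simplices g w a.unop.card
  map ι := TypeCat.ofHom (Simplices.map g w (Quiver.Hom.unop ι))
  map_id a := by
    ext x
    obtain ⟨x, rfl⟩ := Quotient.exists_rep x
    refine Quotient.sound (s := isoSetoid g w _) ?_
    have φ : Nonempty (Iso x.1 x.1) := (isoSetoid g w _).refl x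
    exact (contractsTo_restrict x.1 (Function.Embedding.refl _)).unique φ.some.contractsTo
  map_comp ι κ := by
    ext x
    obtain ⟨x, rfl⟩ := Quotient.exists_rep x
    refine Quotient.sound (s := isoSetoid g w _) ?_
    exact (contractsTo_restrict x.1 _).unique
      ((contractsTo_restrict x.1 _).trans (contractsTo_restrict _ _))

/-- The loop-weight locus: the subcomplex of classes `[G, τ]` such that `G` has a loop or a vertex
of positive weight. -/
noncomputable def loopWeightLocus (g : ℕ) (w : Fin n → ℚ) : Subfunctor (Delta g w) where
  obj a := {σ | ∃ x : {x : LabelledGraph n a.unop.card // x.graph.InGamma g w},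
    σ = Quotient.mk (isoSetoid g w a.unop.card) x ∧ x.1.graph.HasLoopOrWeight}
  map ι := by
    rintro _ ⟨x, rfl, hx⟩
    exact ⟨_, rfl, hasLoopOrWeight_contract _ _ hx⟩

end

end TropicalHassett

/-!
The proof filters the loop-weight locus by the number of edges that are not *tail edges* and
removes the strata one after the other.

A tail of a stable graph is an unmarked vertex of weight one and valence one, or an unmarked
trivalent vertex of weight zero with a loop; it hangs on the rest of the graph by one edge, the tail
edge. Whether an edge is a tail edge does not change when other edges are contracted
(`IsContraction.isTailEdge_iff`): the quantity `2 h(v) - 2 + val(v)` is additive over the fibres of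
a contraction and positive at the unmarked vertices of a stable graph, so nothing can be contracted
to a tail. A graph is saturated if all its loops and weights are in tails. Every graph with a
loop or a weight is a contraction of a saturated graph by tail edges, since one can pull out a tail
for each loop and each unit of weight (`exists_isSaturated`). The saturated graph is unique: for two
saturated graphs over `x`, a tail contracted in the first one comes from a unit of weight or a
loop of `x`, which must lie in a contracted tail of the second one as well, and both graphs contract
to the graph that arises from `x` by pulling out this tail (`exists_common_pull`).

These facts are collected in the notion of a `Saturation` of a symmetric Delta-complex. Given
one, a point of a simplex `x` with core vertices `N` (here, edges that are not tail edges) is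
regarded as a point of the saturated simplex over `x`, and its coordinates in `N` are decreased by
the least among them, for the benefit of the other coordinates, which exist since a saturated
graph in the locus has a tail. On the points that lie in a simplex with at most `i` core
vertices this is a continuous deformation into the points with fewer than `i` core vertices: it is
constant wherever a core coordinate vanishes. By induction every stratum is null homotopic
once the lowest one is, and that one is the image of a single simplex, the saturation of the graph
with no edges. Since stable graphs of genus `g` have boundedly many edges, finitely many strata
exhaust the realization (`Saturation.contractibleSpace`).

Pulling out a tail keeps the graph stable except at a graph with one vertex, genus one and markings
of total weight at most one. In this case the locus consists of a single point.
-/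

namespace TropicalHassett

/-! ### Points of the realization of a symmetric Delta-complex -/

section Realization

variable {X : SymmDeltaComplex}

/-- The simplices of `X` with `n` vertices, that is, of dimension `n - 1`. -/
abbrev Simp (X : SymmDeltaComplex) (n : ℕ) : Type 1 := X.obj (Opposite.op (FinInj.mk n))

/-- The face of a simplex along an injection of vertex sets. -/
def face {k n : ℕ} (ι : Fin k ↪ Fin n) (x : Simp X n) : Simp X k :=
  X.map (Quiver.Hom.op (show FinInj.mk k ⟶ FinInj.mk n from ι)) x

theorem face_face {k l n : ℕ} (ι : Fin k ↪ Fin l) (κ : Fin l ↪ Fin n) (x : Simp X n) :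
    face ι (face κ x) = face (ι.trans κ) x := by
  have := X.map_comp (Quiver.Hom.op (show FinInj.mk l ⟶ FinInj.mk n from κ))
    (Quiver.Hom.op (show FinInj.mk k ⟶ FinInj.mk l from ι))
  exact (ConcreteCategory.congr_hom this x).symm

theorem face_refl {n : ℕ} (x : Simp X n) : face (Function.Embedding.refl _) x = x := by
  have := X.map_id (Opposite.op (FinInj.mk n))
  exact ConcreteCategory.congr_hom this x

theorem isEmpty_stdSimplex_zero : IsEmpty (stdSimplex ℝ (Fin 0)) :=
  ⟨fun a => by simpa using a.2.2⟩

theorem pos_of_stdSimplex {n : ℕ} (a : stdSimplex ℝ (Fin n)) : 0 < n := by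
  rcases n with _ | n
  · exact (isEmpty_stdSimplex_zero.false a).elim
  · omega

/-- The inclusion of a face of the standard simplex. -/
noncomputable abbrev push {k n : ℕ} (ι : Fin k ↪ Fin n) (a : stdSimplex ℝ (Fin k)) :
    stdSimplex ℝ (Fin n) := stdSimplex.map ι a

theorem push_apply {k n : ℕ} (ι : Fin k ↪ Fin n) (a : stdSimplex ℝ (Fin k)) (j : Fin k) :
    push ι a (ι j) = a j := by
  rw [stdSimplex.map_coe, FunOnFinite.linearMap_apply_apply]
  rw [Finset.sum_eq_single j]
  · intro b hb hbj
    exact absurd (ι.injective (Finset.mem_filter.1 hb).2) hbj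
  · simp

theorem push_apply_of_notMem {k n : ℕ} (ι : Fin k ↪ Fin n) (a : stdSimplex ℝ (Fin k))
    {j : Fin n} (hj : j ∉ Set.range ι) : push ι a j = 0 := by
  rw [stdSimplex.map_coe, FunOnFinite.linearMap_apply_apply]
  refine Finset.sum_eq_zero fun b hb => absurd ⟨b, (Finset.mem_filter.1 hb).2⟩ hj

theorem push_push {k l n : ℕ} (ι : Fin k ↪ Fin l) (κ : Fin l ↪ Fin n)
    (a : stdSimplex ℝ (Fin k)) : push κ (push ι a) = push (ι.trans κ) a :=
  stdSimplex.map_comp_apply _ _ _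

theorem push_injective {k n : ℕ} (ι : Fin k ↪ Fin n) : Function.Injective (push ι) := by
  intro a b h
  ext j
  rw [← push_apply ι, h, push_apply]

/-- Every point of a simplex is an interior point of the face spanned by its support. -/
theorem exists_push_eq {n : ℕ} (a : stdSimplex ℝ (Fin n)) :
    ∃ (k : ℕ) (ι : Fin k ↪ Fin n) (b : stdSimplex ℝ (Fin k)), push ι b = a ∧ ∀ j, 0 < b j := by
  classical
  let s : Finset (Fin n) := {j | a j ≠ 0}
  let ι : Fin s.card ↪ Fin n := (s.equivFin.symm.toEmbedding).trans (Function.Embedding.subtype _)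
  have hι : ∀ j, j ∈ Set.range ι ↔ a j ≠ 0 := by
    intro j
    constructor
    · rintro ⟨i, rfl⟩
      exact (Finset.mem_filter.1 (s.equivFin.symm i).2).2
    · intro h
      exact ⟨s.equivFin ⟨j, by simp [s, h]⟩, by simp [ι]⟩
  have hsum : ∑ j, a (ι j) = 1 := by
    rw [← stdSimplex.sum_eq_one a]
    refine Finset.sum_of_injOn ι ι.injective.injOn (by simp) ?_ (fun _ _ => rfl)
    intro j _ hj
    by_contra h
    exact hj (by simpa using (hι j).2 h)
  refine ⟨s.card, ι, ⟨fun j => a (ι j), fun j => stdSimplex.zero_le a _, hsum⟩, ?_, ?_⟩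
  · ext j
    by_cases h : a j = 0
    · rw [push_apply_of_notMem _ _ (by rw [hι]; simpa using h), h]
    · obtain ⟨i, rfl⟩ := (hι j).2 h
      rw [push_apply]; rfl
  · intro j
    exact lt_of_le_of_ne (stdSimplex.zero_le a _) (Ne.symm ((hι _).1 ⟨j, rfl⟩))

/-- The point of the realization with barycentric coordinates `a` in the simplex `x`. -/
def pt : ∀ {n : ℕ}, Simp X n → stdSimplex ℝ (Fin n) → Realization X
  | 0, _, a => (isEmpty_stdSimplex_zero.false a).elim
  | p + 1, x, a => Quot.mk _ ⟨⟨p, x⟩, a⟩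

theorem pt_face {k n : ℕ} (ι : Fin k ↪ Fin n) (x : Simp X n) (a : stdSimplex ℝ (Fin k)) :
    pt (face ι x) a = pt x (push ι a) := by
  rcases k with _ | p
  · exact (isEmpty_stdSimplex_zero.false a).elim
  rcases n with _ | q
  · exact (isEmpty_stdSimplex_zero.false (push ι a)).elim
  exact Quot.sound (RealizationRel.glue (X := X) (p := p) (q := q) ι x a)

theorem continuous_pt {n : ℕ} (x : Simp X n) : Continuous (pt x) := by
  rcases n with _ | p
  · have := isEmpty_stdSimplex_zero
    exact continuous_of_const fun a => (this.false a).elim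
  · exact continuous_quot_mk.comp
      (continuous_sigmaMk (σ := fun x : (Σ p : ℕ, X.obj (Opposite.op (FinInj.std p))) =>
        stdSimplex ℝ (Fin (x.1 + 1))) (i := ⟨p, x⟩))

theorem exists_pt_eq (z : Realization X) :
    ∃ (n : ℕ) (x : Simp X n) (a : stdSimplex ℝ (Fin n)), pt x a = z := by
  obtain ⟨⟨⟨p, x⟩, a⟩, rfl⟩ := Quot.exists_rep z
  exact ⟨p + 1, x, a, rfl⟩

theorem isClosed_iff_pt {C : Set (Realization X)} :
    IsClosed C ↔ ∀ (n : ℕ) (x : Simp X n), IsClosed (pt x ⁻¹' C) := by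
  constructor
  · intro h n x
    exact h.preimage (continuous_pt x)
  · intro h
    refine (isQuotientMap_quot_mk (r := RealizationRel X)).isClosed_preimage.1 ?_
    refine isClosed_sigma_iff.2 ?_
    rintro ⟨p, x⟩
    exact h (p + 1) x

/-- `x` and `y` have a common face in the interior of which the coordinates `a` and `b` agree. -/
def SameSupport {m n : ℕ} (x : Simp X m) (a : stdSimplex ℝ (Fin m)) (y : Simp X n)
    (b : stdSimplex ℝ (Fin n)) : Prop :=
  ∃ (k : ℕ) (ι : Fin k ↪ Fin m) (κ : Fin k ↪ Fin n) (c : stdSimplex ℝ (Fin k)),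
    face ι x = face κ y ∧ push ι c = a ∧ push κ c = b ∧ ∀ j, 0 < c j

theorem SameSupport.symm {m n : ℕ} {x : Simp X m} {a : stdSimplex ℝ (Fin m)} {y : Simp X n}
    {b : stdSimplex ℝ (Fin n)} (h : SameSupport x a y b) : SameSupport y b x a := by
  obtain ⟨k, ι, κ, c, h1, h2, h3, h4⟩ := h
  exact ⟨k, κ, ι, c, h1.symm, h3, h2, h4⟩

theorem mem_range_iff_of_push_eq {k n : ℕ} {ι : Fin k ↪ Fin n} {c : stdSimplex ℝ (Fin k)}
    {a : stdSimplex ℝ (Fin n)} (h : push ι c = a) (hc : ∀ j, 0 < c j) (j : Fin n) :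
    j ∈ Set.range ι ↔ a j ≠ 0 := by
  subst h
  constructor
  · rintro ⟨i, rfl⟩
    rw [push_apply]; exact (hc i).ne'
  · intro hj
    by_contra h
    exact hj (push_apply_of_notMem _ _ h)

/-- Two injections with the same range differ by a bijection of their sources. -/
theorem exists_equiv_of_range_eq {k l n : ℕ} {ι : Fin k ↪ Fin n} {κ : Fin l ↪ Fin n}
    (h : Set.range ι = Set.range κ) :
    ∃ θ : Fin k ≃ Fin l, θ.toEmbedding.trans κ = ι := by
  refine ⟨(Equiv.ofInjective ι ι.injective).trans
    ((Equiv.setCongr h).trans (Equiv.ofInjective κ κ.injective).symm), ?_⟩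
  ext j
  simp [Equiv.apply_ofInjective_symm]

theorem SameSupport.trans {l m n : ℕ} {x : Simp X l} {a : stdSimplex ℝ (Fin l)} {y : Simp X m}
    {b : stdSimplex ℝ (Fin m)} {z : Simp X n} {c : stdSimplex ℝ (Fin n)}
    (h : SameSupport x a y b) (h' : SameSupport y b z c) : SameSupport x a z c := by
  obtain ⟨k, ι, κ, d, h1, h2, h3, h4⟩ := h
  obtain ⟨k', ι', κ', d', h1', h2', h3', h4'⟩ := h'
  have hr : Set.range κ = Set.range ι' := by
    ext j
    rw [mem_range_iff_of_push_eq h3 h4, mem_range_iff_of_push_eq h2' h4']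
  obtain ⟨θ, rfl⟩ := exists_equiv_of_range_eq hr
  refine ⟨k, ι, θ.toEmbedding.trans κ', d, ?_, h2, ?_, h4⟩
  · rw [h1, ← face_face, h1', face_face]
  · have : push θ.toEmbedding d = d' := by
      apply push_injective ι'
      rw [push_push, h3, h2']
    rw [← push_push, this, h3']

/-- Two points of simplices have the same image in the realization only if they agree in the
interior of a common face. -/
theorem sameSupport_of_pt_eq {m n : ℕ} {x : Simp X m} {a : stdSimplex ℝ (Fin m)} {y : Simp X n}
    {b : stdSimplex ℝ (Fin n)} (h : pt x a = pt y b) : SameSupport x a y b := by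
  have refl : ∀ {n : ℕ} (x : Simp X n) (a : stdSimplex ℝ (Fin n)), SameSupport x a x a := by
    intro n x a
    obtain ⟨k, ι, c, h1, h2⟩ := exists_push_eq a
    exact ⟨k, ι, ι, c, rfl, h1, h1, h2⟩
  rcases m with _ | p
  · exact (isEmpty_stdSimplex_zero.false a).elim
  rcases n with _ | q
  · exact (isEmpty_stdSimplex_zero.false b).elim
  have key : ∀ s t, Relation.EqvGen (RealizationRel X) s t →
      SameSupport (X := X) (m := s.1.1 + 1) (n := t.1.1 + 1) s.1.2 s.2 t.1.2 t.2 := by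
    intro s t hst
    induction hst with
    | rel s t hst =>
      obtain ⟨ι, x, a⟩ := hst
      obtain ⟨k, κ, c, h1, h2⟩ := exists_push_eq a
      refine ⟨k, κ, κ.trans ι, c, face_face _ _ _, h1, ?_, h2⟩
      exact (push_push κ (show Fin _ ↪ Fin _ from ι) c).symm.trans (congrArg _ h1)
    | refl s => exact refl _ _
    | symm s t _ ih => exact ih.symm
    | trans s t u _ _ ih1 ih2 => exact ih1.trans ih2
  exact key ⟨⟨p, x⟩, a⟩ ⟨⟨q, y⟩, b⟩ (Quot.eqvGen_exact h)

end Realization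

end TropicalHassett

namespace TropicalHassett

/-! ### Saturations and the contractibility criterion -/

section Saturation

/-- A distinguished set of vertices of a symmetric Delta-complex, given by its complement `core`,
together with a class of saturated simplices, such that every simplex `x` is a face of a saturated
simplex that has no further core vertices. The exchange axiom makes this saturated simplex unique
up to a relabelling that fixes the vertices of `x`. -/
structure Saturation (X : SymmDeltaComplex) where
  core : ∀ {n : ℕ}, Simp X n → Finset (Fin n)
  mem_core_face : ∀ {k n : ℕ} (ι : Fin k ↪ Fin n) (x : Simp X n) (j : Fin k),
    j ∈ core (face ι x) ↔ ι j ∈ core x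
  Sat : ∀ {n : ℕ}, Simp X n → Prop
  exists_sat : ∀ {n : ℕ} (x : Simp X n), ∃ (m : ℕ) (y : Simp X m) (ι : Fin n ↪ Fin m),
    Sat y ∧ face ι y = x ∧ ∀ j ∉ Set.range ι, j ∉ core y
  exchange : ∀ {n m m' : ℕ} {y : Simp X m} {y' : Simp X m'} {ι : Fin n ↪ Fin m}
    {ι' : Fin n ↪ Fin m'}, Sat y → Sat y' → (∀ j ∉ Set.range ι, j ∉ core y) →
    (∀ j ∉ Set.range ι', j ∉ core y') → face ι y = face ι' y' →
    ∀ (j : Fin m) (hj : j ∉ Set.range ι), ∃ (j' : Fin m') (hj' : j' ∉ Set.range ι'),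
      face (Fin.Embedding.snoc ι hj) y = face (Fin.Embedding.snoc ι' hj') y'
  exists_notMem_core : ∀ {n : ℕ} {y : Simp X n}, Sat y → ∃ j, j ∉ core y

namespace Saturation

variable {X : SymmDeltaComplex} (S : Saturation X)

/-- `y` is a saturated simplex that arises from `x` by adding vertices outside the core. -/
def IsSaturationOf {n m : ℕ} (ι : Fin n ↪ Fin m) (y : Simp X m) (x : Simp X n) : Prop :=
  S.Sat y ∧ face ι y = x ∧ ∀ j ∉ Set.range ι, j ∉ S.core y

theorem isSaturationOf_unique {n m m' : ℕ} {x : Simp X n} {y : Simp X m} {y' : Simp X m'}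
    {ι : Fin n ↪ Fin m} {ι' : Fin n ↪ Fin m'} (h : S.IsSaturationOf ι y x)
    (h' : S.IsSaturationOf ι' y' x) :
    ∃ θ : Fin m ≃ Fin m', face θ.toEmbedding y' = y ∧ ι.trans θ.toEmbedding = ι' := by
  obtain ⟨d, hd⟩ : ∃ d, m = n + d :=
    Nat.exists_eq_add_of_le (by simpa using Fintype.card_le_of_embedding ι)
  induction d generalizing n with
  | zero =>
    have hι : Function.Surjective ι :=
      ((Fintype.bijective_iff_injective_and_card ι).2 ⟨ι.injective, by simp [hd]⟩).2
    have hι' : Function.Surjective ι' := by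
      intro j
      by_contra hj
      obtain ⟨j', hj', -⟩ := S.exchange h'.1 h.1 h'.2.2 h.2.2 (h'.2.1.trans h.2.1.symm) j hj
      exact hj' (hι j')
    obtain ⟨e, rfl⟩ : ∃ e : Fin n ≃ Fin m, e.toEmbedding = ι :=
      ⟨Equiv.ofBijective ι ⟨ι.injective, hι⟩, by ext j; rfl⟩
    obtain ⟨e', rfl⟩ : ∃ e : Fin n ≃ Fin m', e.toEmbedding = ι' :=
      ⟨Equiv.ofBijective ι' ⟨ι'.injective, hι'⟩, by ext j; rfl⟩
    refine ⟨e.symm.trans e', ?_, by ext j; simp⟩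
    have e1 : (e.symm.trans e').toEmbedding = e.symm.toEmbedding.trans e'.toEmbedding := by
      ext j; simp
    have e2 : e.symm.toEmbedding.trans e.toEmbedding = Function.Embedding.refl _ := by
      ext j; simp
    rw [e1, ← face_face, h'.2.1, ← h.2.1, face_face, e2, face_refl]
  | succ d ih =>
    have hι : ¬ Function.Surjective ι := by
      intro hs
      have := Fintype.card_le_of_surjective ι hs
      simp at this; omega
    obtain ⟨j, hj⟩ : ∃ j, j ∉ Set.range ι := not_forall.1 hι
    obtain ⟨j', hj', hf⟩ := S.exchange h.1 h'.1 h.2.2 h'.2.2 (h.2.1.trans h'.2.1.symm) j hj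
    have hsub : ∀ {m : ℕ} {ι : Fin n ↪ Fin m} {j : Fin m} (hj : j ∉ Set.range ι),
        Set.range ι ⊆ Set.range (Fin.Embedding.snoc ι hj) := by
      rintro m ι j hj _ ⟨i, rfl⟩
      exact ⟨i.castSucc, by simp⟩
    obtain ⟨θ, hθ, hθ'⟩ := ih (x := face (Fin.Embedding.snoc ι hj) y)
      ⟨h.1, rfl, fun i hi => h.2.2 i fun hh => hi (hsub hj hh)⟩
      ⟨h'.1, hf.symm, fun i hi => h'.2.2 i fun hh => hi (hsub hj' hh)⟩ (by omega)
    refine ⟨θ, hθ, ?_⟩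
    ext i
    have := DFunLike.congr_fun hθ' i.castSucc
    rw [Function.Embedding.trans_apply, Fin.Embedding.snoc_castSucc,
      Fin.Embedding.snoc_castSucc] at this
    exact congrArg Fin.val this

theorem exists_isSaturationOf {n : ℕ} (x : Simp X n) : ∃ (m : ℕ) (y : Simp X m)
    (ι : Fin n ↪ Fin m), S.IsSaturationOf ι y x := S.exists_sat x

theorem core_eq_map {n m : ℕ} {ι : Fin n ↪ Fin m} {y : Simp X m} {x : Simp X n}
    (h : face ι y = x) (hc : ∀ j ∉ Set.range ι, j ∉ S.core y) :
    S.core y = (S.core x).map ι := by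
  ext j
  rw [Finset.mem_map]
  constructor
  · intro hj
    by_cases hr : j ∈ Set.range ι
    · obtain ⟨i, rfl⟩ := hr
      exact ⟨i, by rwa [← h, S.mem_core_face], rfl⟩
    · exact absurd hj (hc j hr)
  · rintro ⟨i, hi, rfl⟩
    rwa [← h, S.mem_core_face] at hi

theorem IsSaturationOf.core_eq {S : Saturation X} {n m : ℕ} {ι : Fin n ↪ Fin m} {y : Simp X m}
    {x : Simp X n} (h : S.IsSaturationOf ι y x) : S.core y = (S.core x).map ι :=
  S.core_eq_map h.2.1 h.2.2

theorem card_core_face_le {k n : ℕ} (κ : Fin k ↪ Fin n) (x : Simp X n) :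
    (S.core (face κ x)).card ≤ (S.core x).card := by
  rw [← Finset.card_map κ]
  refine Finset.card_le_card fun j hj => ?_
  obtain ⟨i, hi, rfl⟩ := Finset.mem_map.1 hj
  exact (S.mem_core_face _ _ _).1 hi

theorem card_core_face_lt {k n : ℕ} (κ : Fin k ↪ Fin n) (x : Simp X n) {j : Fin n}
    (hj : j ∉ Set.range κ) (hjx : j ∈ S.core x) :
    (S.core (face κ x)).card < (S.core x).card := by
  rw [← Finset.card_map κ]
  refine Finset.card_lt_card (Finset.ssubset_iff_of_subset ?_ |>.2 ⟨j, hjx, ?_⟩)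
  · intro j hj
    obtain ⟨i, hi, rfl⟩ := Finset.mem_map.1 hj
    exact (S.mem_core_face _ _ _).1 hi
  · intro h
    obtain ⟨i, -, rfl⟩ := Finset.mem_map.1 h
    exact hj ⟨i, rfl⟩

/-- The points that lie in a simplex with at most `i` core vertices. -/
def stratum (i : ℕ) : Set (Realization X) :=
  {z | ∃ (n : ℕ) (x : Simp X n) (a : stdSimplex ℝ (Fin n)), (S.core x).card ≤ i ∧ pt x a = z}

theorem pt_mem_stratum {i n : ℕ} {x : Simp X n} (h : (S.core x).card ≤ i)
    (a : stdSimplex ℝ (Fin n)) : pt x a ∈ S.stratum i := ⟨n, x, a, h, rfl⟩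

/-- A point of a stratum lies in a face, of any given simplex containing it, that belongs to the
stratum. -/
theorem exists_face_of_mem_stratum {i n : ℕ} {x : Simp X n} {a : stdSimplex ℝ (Fin n)}
    (h : pt x a ∈ S.stratum i) : ∃ (k : ℕ) (κ : Fin k ↪ Fin n) (b : stdSimplex ℝ (Fin k)),
      (S.core (face κ x)).card ≤ i ∧ push κ b = a := by
  obtain ⟨m, y, c, hy, hc⟩ := h
  obtain ⟨k, ι, κ, d, h1, h2, h3, h4⟩ := sameSupport_of_pt_eq hc
  exact ⟨k, κ, d, by rw [← h1]; exact (S.card_core_face_le ι y).trans hy, h3⟩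

/-- The disjoint union of the simplices with at most `i` core vertices. -/
abbrev StratumCover (i : ℕ) : Type 1 :=
  Σ x : (Σ n : ℕ, {x : Simp X n // (S.core x).card ≤ i}), stdSimplex ℝ (Fin x.1)

/-- The simplices with at most `i` core vertices cover the corresponding stratum. -/
def stratumMap (i : ℕ) (s : S.StratumCover i) : S.stratum i :=
  ⟨pt s.1.2.1 s.2, S.pt_mem_stratum s.1.2.2 s.2⟩

/-- The subspace topology of a stratum agrees with its topology as a subcomplex, because a closed
subset meets each simplex in a finite union of closed subsets of faces. -/
theorem isQuotientMap_stratumMap (i : ℕ) : Topology.IsQuotientMap (S.stratumMap i) := by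
  have hcont : Continuous (S.stratumMap i) := by
    refine continuous_sigma fun x => ?_
    exact (continuous_pt x.2.1).subtype_mk _
  refine Topology.isQuotientMap_iff_isClosed.2 ⟨?_, fun C => ⟨fun h => h.preimage hcont, ?_⟩⟩
  · rintro ⟨_, n, x, a, hx, rfl⟩
    exact ⟨⟨⟨n, x, hx⟩, a⟩, rfl⟩
  · intro hC
    have hC' : ∀ (n : ℕ) (x : Simp X n), (S.core x).card ≤ i →
        IsClosed (pt x ⁻¹' (Subtype.val '' C)) := by
      intro n x hx
      have := isClosed_sigma_iff.1 hC ⟨n, x, hx⟩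
      refine (congrArg IsClosed ?_).mp this
      ext a
      constructor
      · intro h
        exact ⟨_, h, rfl⟩
      · rintro ⟨z, hz, hza⟩
        have : S.stratumMap i ⟨⟨n, x, hx⟩, a⟩ = z := Subtype.ext hza.symm
        change S.stratumMap i ⟨⟨n, x, hx⟩, a⟩ ∈ C
        rwa [this]
    have key : IsClosed (Subtype.val '' C) := by
      refine isClosed_iff_pt.2 fun n x => ?_
      have : pt x ⁻¹' (Subtype.val '' C) = ⋃ k : Fin (n + 1), ⋃ κ : Fin k ↪ Fin n,
          ⋃ _ : (S.core (face κ x)).card ≤ i,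
            push κ '' (pt (face κ x) ⁻¹' (Subtype.val '' C)) := by
        ext a
        simp only [Set.mem_iUnion]
        constructor
        · rintro h
          obtain ⟨z, hz, hza⟩ := h
          have hm : pt x a ∈ S.stratum i := hza ▸ z.2
          obtain ⟨k, κ, b, hk, hb⟩ := S.exists_face_of_mem_stratum hm
          have hkn : k ≤ n := by simpa using Fintype.card_le_of_embedding κ
          refine ⟨⟨k, by omega⟩, κ, hk, b, ?_, hb⟩
          rw [Set.mem_preimage, pt_face, hb]
          exact ⟨z, hz, hza⟩
        · rintro ⟨k, κ, hk, b, hb, rfl⟩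
          rwa [Set.mem_preimage, pt_face] at hb
      rw [this]
      refine isClosed_iUnion_of_finite fun k => isClosed_iUnion_of_finite fun κ =>
        isClosed_iUnion_of_finite fun hk => ?_
      exact ((hC' _ _ hk).isCompact.image (stdSimplex.continuous_map κ)).isClosed
    have := key.preimage (continuous_subtype_val (p := (· ∈ S.stratum i)))
    rwa [Set.preimage_image_eq _ Subtype.val_injective] at this

/-- The segment between two points of the standard simplex. -/
noncomputable def segment {n : ℕ} (a b : stdSimplex ℝ (Fin n)) (t : unitInterval) :
    stdSimplex ℝ (Fin n) :=
  ⟨fun j => (1 - t) * a j + t * b j, by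
    refine ⟨fun j => ?_, ?_⟩
    · have := t.2.1
      have := t.2.2
      have := stdSimplex.zero_le a j
      have := stdSimplex.zero_le b j
      have : 0 ≤ 1 - (t : ℝ) := by linarith
      positivity
    · rw [Finset.sum_add_distrib, ← Finset.mul_sum, ← Finset.mul_sum, stdSimplex.sum_eq_one,
        stdSimplex.sum_eq_one]
      ring⟩

theorem segment_apply {n : ℕ} (a b : stdSimplex ℝ (Fin n)) (t : unitInterval) (j : Fin n) :
    segment a b t j = (1 - t) * a j + t * b j := rfl

theorem segment_zero {n : ℕ} (a b : stdSimplex ℝ (Fin n)) : segment a b 0 = a := by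
  ext j; simp [segment_apply]

theorem segment_one {n : ℕ} (a b : stdSimplex ℝ (Fin n)) : segment a b 1 = b := by
  ext j; simp [segment_apply]

theorem segment_self {n : ℕ} (a : stdSimplex ℝ (Fin n)) (t : unitInterval) :
    segment a a t = a := by
  ext j; rw [segment_apply]; ring

theorem continuous_coord {n : ℕ} (j : Fin n) :
    Continuous fun a : stdSimplex ℝ (Fin n) => a j :=
  (continuous_apply j).comp continuous_subtype_val

theorem push_segment {m n : ℕ} (θ : Fin m ≃ Fin n) (a b : stdSimplex ℝ (Fin m))
    (t : unitInterval) :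
    push θ.toEmbedding (segment a b t) =
      segment (push θ.toEmbedding a) (push θ.toEmbedding b) t := by
  ext j
  obtain ⟨i, rfl⟩ := θ.surjective j
  have h := fun c => push_apply θ.toEmbedding c i
  simp only [Equiv.coe_toEmbedding] at h
  rw [segment_apply, h, h, h, segment_apply]

/-- A family of continuous self-maps of the standard simplices, depending on a set `N` of
vertices, that is invariant under relabelling. It is required to be the identity if `N` has fewer
than `i` elements, and at the points that have a vanishing coordinate in `N`. -/
structure Push (i : ℕ) where
  toFun : ∀ {m : ℕ}, Finset (Fin m) → stdSimplex ℝ (Fin m) → stdSimplex ℝ (Fin m)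
  continuous : ∀ {m : ℕ} (N : Finset (Fin m)), Continuous (toFun N)
  equivariant : ∀ {m m' : ℕ} (θ : Fin m ≃ Fin m') (N : Finset (Fin m)) (a),
    toFun (N.map θ.toEmbedding) (push θ.toEmbedding a) = push θ.toEmbedding (toFun N a)
  eq_of_card_lt : ∀ {m : ℕ} (N : Finset (Fin m)) (a), N.card < i → toFun N a = a
  eq_of_apply_eq_zero : ∀ {m : ℕ} (N : Finset (Fin m)) (a), (∃ j ∈ N, a j = 0) → toFun N a = a

/-- The straight line homotopy to the map `T`, carried out in a saturation of `x`. -/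
noncomputable def flow {i : ℕ} (T : Push i) {n : ℕ} (x : Simp X n) (a : stdSimplex ℝ (Fin n))
    (t : unitInterval) : Realization X :=
  let h := (S.exists_isSaturationOf x)
  let y := h.choose_spec.choose
  let ι := h.choose_spec.choose_spec.choose
  pt y (segment (push ι a) (T.toFun (S.core y) (push ι a)) t)

theorem flow_eq {i : ℕ} (T : Push i) {n m : ℕ} {ι : Fin n ↪ Fin m} {y : Simp X m} {x : Simp X n}
    (h : S.IsSaturationOf ι y x) (a : stdSimplex ℝ (Fin n)) (t : unitInterval) :
    S.flow T x a t = pt y (segment (push ι a) (T.toFun (S.core y) (push ι a)) t) := by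
  have key : ∀ {m' : ℕ} {ι' : Fin n ↪ Fin m'} {y' : Simp X m'}, S.IsSaturationOf ι' y' x →
      pt y' (segment (push ι' a) (T.toFun (S.core y') (push ι' a)) t) =
        pt y (segment (push ι a) (T.toFun (S.core y) (push ι a)) t) := by
    intro m' ι' y' h'
    obtain ⟨θ, rfl, rfl⟩ := S.isSaturationOf_unique h' h
    have hc : S.core y = (S.core (face θ.toEmbedding y)).map θ.toEmbedding :=
      S.core_eq_map rfl fun j hj => absurd ⟨θ.symm j, by simp⟩ hj
    rw [pt_face, push_segment, ← T.equivariant, ← hc, push_push]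
  exact key (S.exists_isSaturationOf x).choose_spec.choose_spec.choose_spec

theorem continuous_flow {i : ℕ} (T : Push i) {n : ℕ} (x : Simp X n) :
    Continuous fun p : stdSimplex ℝ (Fin n) × unitInterval => S.flow T x p.1 p.2 := by
  obtain ⟨m, y, ι, h⟩ := S.exists_isSaturationOf x
  simp only [S.flow_eq T h]
  refine (continuous_pt y).comp ?_
  refine Continuous.subtype_mk (continuous_pi fun j => ?_) _
  have h1 : Continuous fun p : stdSimplex ℝ (Fin n) × unitInterval => push ι p.1 :=
    (stdSimplex.continuous_map ι).comp continuous_fst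
  have h2 := (continuous_coord j).comp h1
  have h3 := (continuous_coord j).comp ((T.continuous (S.core y)).comp h1)
  have h4 : Continuous fun p : stdSimplex ℝ (Fin n) × unitInterval => ((p.2 : unitInterval) : ℝ) :=
    continuous_subtype_val.comp continuous_snd
  exact ((continuous_const.sub h4).mul h2).add (h4.mul h3)

theorem flow_zero {i : ℕ} (T : Push i) {n : ℕ} (x : Simp X n) (a : stdSimplex ℝ (Fin n)) :
    S.flow T x a 0 = pt x a := by
  obtain ⟨m, y, ι, h⟩ := S.exists_isSaturationOf x
  rw [S.flow_eq T h, segment_zero, ← pt_face, h.2.1]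

theorem flow_eq_pt {i : ℕ} (T : Push i) {n : ℕ} (x : Simp X n) (a : stdSimplex ℝ (Fin n))
    (t : unitInterval) (hx : (S.core x).card < i ∨ ∃ j ∈ S.core x, a j = 0) :
    S.flow T x a t = pt x a := by
  obtain ⟨m, y, ι, h⟩ := S.exists_isSaturationOf x
  have : T.toFun (S.core y) (push ι a) = push ι a := by
    rcases hx with hx | ⟨j, hj, hj0⟩
    · exact T.eq_of_card_lt _ _ (by rwa [h.core_eq, Finset.card_map])
    · refine T.eq_of_apply_eq_zero _ _ ⟨ι j, ?_, by rwa [push_apply]⟩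
      rw [h.core_eq]
      exact Finset.mem_map_of_mem _ hj
  rw [S.flow_eq T h, this, segment_self, ← pt_face, h.2.1]

theorem flow_face {i : ℕ} (T : Push i) {k n : ℕ} (κ : Fin k ↪ Fin n) (x : Simp X n)
    (hx : (S.core x).card ≤ i) (a : stdSimplex ℝ (Fin k)) (t : unitInterval) :
    S.flow T (face κ x) a t = S.flow T x (push κ a) t := by
  by_cases hκ : ∀ j ∉ Set.range κ, j ∉ S.core x
  · obtain ⟨m, y, ι, h⟩ := S.exists_isSaturationOf x
    have h' : S.IsSaturationOf (κ.trans ι) y (face κ x) := by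
      refine ⟨h.1, by rw [← face_face, h.2.1], fun j hj hjy => ?_⟩
      rw [h.core_eq] at hjy
      obtain ⟨i, hi, rfl⟩ := Finset.mem_map.1 hjy
      refine hκ i ?_ hi
      rintro ⟨l, rfl⟩
      exact hj ⟨l, rfl⟩
    rw [S.flow_eq T h, S.flow_eq T h', push_push]
  · push Not at hκ
    obtain ⟨j, hj, hjx⟩ := hκ
    rw [S.flow_eq_pt T x _ t (Or.inr ⟨j, hjx, push_apply_of_notMem _ _ hj⟩),
      S.flow_eq_pt T _ a t (Or.inl ((S.card_core_face_lt κ x hj hjx).trans_le hx)), pt_face]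

theorem flow_congr {i : ℕ} (T : Push i) {m n : ℕ} {x : Simp X m} {y : Simp X n}
    {a : stdSimplex ℝ (Fin m)} {b : stdSimplex ℝ (Fin n)} (hx : (S.core x).card ≤ i)
    (hy : (S.core y).card ≤ i) (h : pt x a = pt y b) (t : unitInterval) :
    S.flow T x a t = S.flow T y b t := by
  obtain ⟨k, ι, κ, c, h1, rfl, rfl, -⟩ := sameSupport_of_pt_eq h
  rw [← S.flow_face T ι x hx, ← S.flow_face T κ y hy, h1]

/-- The inclusion of a stratum. -/
def stratumIncl (i : ℕ) : C(S.stratum i, Realization X) := ⟨Subtype.val, continuous_subtype_val⟩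

theorem exists_homotopy {i : ℕ} (T : Push i) : ∃ r : C(S.stratum i, Realization X),
    (S.stratumIncl i).Homotopic r ∧ ∀ {n : ℕ} (x : Simp X n) (hx : (S.core x).card ≤ i)
      (a : stdSimplex ℝ (Fin n)), r ⟨pt x a, S.pt_mem_stratum hx a⟩ = S.flow T x a 1 := by
  let F : S.stratum i × unitInterval → Realization X := fun p =>
    S.flow T p.1.2.choose_spec.choose p.1.2.choose_spec.choose_spec.choose p.2
  have hF : ∀ {n : ℕ} (x : Simp X n) (hx : (S.core x).card ≤ i)
      (a : stdSimplex ℝ (Fin n)) (t : unitInterval),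
      F (⟨pt x a, S.pt_mem_stratum hx a⟩, t) = S.flow T x a t := by
    intro n x hx a t
    have h := (S.pt_mem_stratum hx a).choose_spec.choose_spec.choose_spec
    exact S.flow_congr T h.1 hx h.2 t
  have hcont : Continuous F := by
    refine (S.isQuotientMap_stratumMap i).continuous_lift_prod_left ?_
    -- The product with the interval is the disjoint union of the products of the simplices.
    have key : Continuous ((fun p : S.StratumCover i × unitInterval =>
        F (S.stratumMap i p.1, p.2)) ∘ Homeomorph.sigmaProdDistrib.symm) := by
      refine continuous_sigma fun x => ?_
      exact (S.continuous_flow T x.2.1).congr fun p => (hF x.2.1 x.2.2 p.1 p.2).symm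
    exact (Homeomorph.comp_continuous_iff' (Homeomorph.sigmaProdDistrib.symm)).1 key
  refine ⟨⟨fun z => F (z, 1), hcont.comp (by fun_prop)⟩, ⟨⟨⟨fun p => F (p.2, p.1),
    hcont.comp (by fun_prop)⟩, ?_, fun z => rfl⟩⟩, fun x hx a => hF x hx a 1⟩
  rintro ⟨_, n, x, a, hx, rfl⟩
  exact (hF x hx a 0).trans (S.flow_zero T x a)

end Saturation

end Saturation

end TropicalHassett

namespace TropicalHassett

namespace Saturation

/-! ### Draining the core -/

section Criterion

/-- The least coordinate of `a` in `N`. -/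
noncomputable def minCoord {m : ℕ} (N : Finset (Fin m)) (a : stdSimplex ℝ (Fin m)) : ℝ :=
  if h : N.Nonempty then N.inf' h a else 0

theorem minCoord_nonneg {m : ℕ} (N : Finset (Fin m)) (a : stdSimplex ℝ (Fin m)) :
    0 ≤ minCoord N a := by
  unfold minCoord
  split_ifs with h
  · exact (Finset.le_inf'_iff h _).2 fun j _ => stdSimplex.zero_le a j
  · exact le_rfl

theorem minCoord_le {m : ℕ} {N : Finset (Fin m)} (a : stdSimplex ℝ (Fin m)) {j : Fin m}
    (hj : j ∈ N) : minCoord N a ≤ a j := by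
  rw [minCoord, dif_pos ⟨j, hj⟩]
  exact Finset.inf'_le _ hj

theorem exists_eq_minCoord {m : ℕ} {N : Finset (Fin m)} (h : N.Nonempty)
    (a : stdSimplex ℝ (Fin m)) : ∃ j ∈ N, a j = minCoord N a := by
  rw [minCoord, dif_pos h]
  obtain ⟨j, hj, h'⟩ := Finset.exists_mem_eq_inf' h a
  exact ⟨j, hj, h'.symm⟩

theorem continuous_minCoord {m : ℕ} (N : Finset (Fin m)) : Continuous (minCoord N) := by
  unfold minCoord
  split_ifs with h
  · exact Continuous.finset_inf'_apply h fun j _ => continuous_coord j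
  · exact continuous_const

theorem minCoord_map {m m' : ℕ} (θ : Fin m ≃ Fin m') (N : Finset (Fin m))
    (a : stdSimplex ℝ (Fin m)) :
    minCoord (N.map θ.toEmbedding) (push θ.toEmbedding a) = minCoord N a := by
  unfold minCoord
  simp only [Finset.map_nonempty]
  split_ifs with h
  · rw [Finset.inf'_map]
    exact Finset.inf'_congr h rfl fun j _ => push_apply θ.toEmbedding a j
  · rfl

/-- Subtract the least coordinate in `N` from all coordinates in `N`, and distribute the loss
evenly over the other coordinates. -/
noncomputable def drain {m : ℕ} (N : Finset (Fin m)) (h : Nᶜ.Nonempty)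
    (a : stdSimplex ℝ (Fin m)) : stdSimplex ℝ (Fin m) :=
  ⟨fun j => if j ∈ N then a j - minCoord N a else a j + minCoord N a * N.card / Nᶜ.card, by
    have hpos : (0 : ℝ) < Nᶜ.card := by exact_mod_cast h.card_pos
    refine ⟨fun j => ?_, ?_⟩
    · dsimp only
      split_ifs with hj
      · exact sub_nonneg.2 (minCoord_le a hj)
      · have := minCoord_nonneg N a
        have := stdSimplex.zero_le a j
        positivity
    · rw [← Finset.sum_add_sum_compl N, Finset.sum_congr rfl fun j hj => if_pos hj,
        Finset.sum_congr (s₁ := Nᶜ) rfl fun j hj => if_neg (Finset.mem_compl.1 hj),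
        Finset.sum_sub_distrib, Finset.sum_add_distrib, Finset.sum_const, Finset.sum_const,
        nsmul_eq_mul, nsmul_eq_mul, mul_div_cancel₀ _ hpos.ne']
      have := stdSimplex.sum_eq_one a
      rw [← Finset.sum_add_sum_compl N] at this
      linarith⟩

theorem drain_apply {m : ℕ} (N : Finset (Fin m)) (h : Nᶜ.Nonempty) (a : stdSimplex ℝ (Fin m))
    (j : Fin m) : drain N h a j =
      if j ∈ N then a j - minCoord N a else a j + minCoord N a * N.card / Nᶜ.card := rfl

/-- Draining the vertices in `N`, if there are exactly `i + 1` of them. -/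
noncomputable def drainPush (i : ℕ) : Push (i + 1) where
  toFun N a := if h : N.card = i + 1 ∧ Nᶜ.Nonempty then drain N h.2 a else a
  continuous N := by
    split_ifs with h
    · refine Continuous.subtype_mk (continuous_pi fun j => ?_) _
      have h1 := continuous_minCoord N
      have h2 := continuous_coord j
      split_ifs
      · exact h2.sub h1
      · exact h2.add ((h1.mul continuous_const).div_const _)
    · exact continuous_id
  equivariant {m m'} θ N a := by
    obtain rfl : m = m' := by simpa using Fintype.card_congr θ
    have hc : (N.map θ.toEmbedding)ᶜ.card = Nᶜ.card := by
      rw [Finset.card_compl, Finset.card_compl, Finset.card_map]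
    have hiff : ((N.map θ.toEmbedding).card = i + 1 ∧ (N.map θ.toEmbedding)ᶜ.Nonempty) ↔
        (N.card = i + 1 ∧ Nᶜ.Nonempty) := by
      rw [Finset.card_map, ← Finset.card_pos, ← Finset.card_pos, hc]
    by_cases h : N.card = i + 1 ∧ Nᶜ.Nonempty
    · rw [dif_pos h, dif_pos (hiff.2 h)]
      ext j
      obtain ⟨j, rfl⟩ := θ.surjective j
      have hp := fun b => push_apply θ.toEmbedding b j
      simp only [Equiv.coe_toEmbedding] at hp
      rw [hp, drain_apply, drain_apply, hc, Finset.card_map, minCoord_map, hp]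
      simp
    · rw [dif_neg h, dif_neg (fun h' => h (hiff.1 h'))]
  eq_of_card_lt N a h := dif_neg fun h' => by omega
  eq_of_apply_eq_zero N a h := by
    obtain ⟨j, hj, h0⟩ := h
    have : minCoord N a = 0 := le_antisymm (h0 ▸ minCoord_le a hj) (minCoord_nonneg N a)
    split_ifs
    · ext j
      rw [drain_apply, this]
      simp
    · rfl

/-- The barycentre of the standard simplex. -/
noncomputable def barycentre {m : ℕ} (hm : 0 < m) : stdSimplex ℝ (Fin m) :=
  ⟨fun _ => (m : ℝ)⁻¹, fun _ => by positivity, by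
    have : (m : ℝ) ≠ 0 := by positivity
    simp [this]⟩

theorem push_barycentre {m m' : ℕ} (θ : Fin m ≃ Fin m') (hm : 0 < m) (hm' : 0 < m') :
    push θ.toEmbedding (barycentre hm) = barycentre hm' := by
  obtain rfl : m = m' := by simpa using Fintype.card_congr θ
  ext j
  obtain ⟨j, rfl⟩ := θ.surjective j
  exact push_apply θ.toEmbedding _ j

/-- The constant map to the barycentre, if there are no core vertices. -/
noncomputable def barycentrePush : Push 0 where
  toFun N a := if N = ∅ then barycentre (pos_of_stdSimplex a) else a
  continuous N := by
    split_ifs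
    · exact continuous_of_const fun a b => rfl
    · exact continuous_id
  equivariant θ N a := by
    simp only [Finset.map_eq_empty]
    split_ifs
    · exact (push_barycentre θ _ _).symm
    · rfl
  eq_of_card_lt N a h := absurd h (Nat.not_lt_zero _)
  eq_of_apply_eq_zero N a h := by
    obtain ⟨j, hj, -⟩ := h
    exact if_neg (Finset.ne_empty_of_mem hj)

variable {X : SymmDeltaComplex} (S : Saturation X)

/-- All simplices without core vertices are faces of one saturated simplex, so their union can be
contracted to the barycentre of the latter. -/
theorem nullhomotopic_stratumIncl_zero [Nonempty (Simp X 0)] [Subsingleton (Simp X 0)] :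
    (S.stratumIncl 0).Nullhomotopic := by
  obtain ⟨r, hr, hr'⟩ := S.exists_homotopy barycentrePush
  obtain ⟨x₀⟩ := ‹Nonempty (Simp X 0)›
  obtain ⟨m₀, y₀, ι₀, h₀⟩ := S.exists_isSaturationOf x₀
  have hm₀ : 0 < m₀ := (S.exists_notMem_core h₀.1).choose.pos
  refine ⟨pt y₀ (barycentre hm₀), hr.trans ?_⟩
  convert ContinuousMap.Homotopic.refl _
  ext ⟨_, n, x, a, hx, rfl⟩
  obtain ⟨m, y, ι, h⟩ := S.exists_isSaturationOf x
  have hy : S.core y = ∅ := by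
    rw [h.core_eq, Finset.card_eq_zero.1 (Nat.le_zero.1 hx), Finset.map_empty]
  have h' : S.IsSaturationOf (⟨Fin.elim0, fun i => i.elim0⟩ : Fin 0 ↪ Fin m) y x₀ :=
    ⟨h.1, Subsingleton.elim _ _, fun j _ => by simp [hy]⟩
  obtain ⟨θ, hθ, -⟩ := S.isSaturationOf_unique h₀ h'
  have hb : barycentrePush.toFun (S.core y) (push ι a) =
      barycentre (pos_of_stdSimplex (push ι a)) := if_pos hy
  rw [ContinuousMap.const_apply, hr' x hx a, S.flow_eq _ h, segment_one, hb, ← hθ, pt_face,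
    push_barycentre]

/-- Draining the core vertices moves each stratum into the preceding one. -/
theorem nullhomotopic_stratumIncl_succ {i : ℕ} (hi : (S.stratumIncl i).Nullhomotopic) :
    (S.stratumIncl (i + 1)).Nullhomotopic := by
  obtain ⟨r, hr, hr'⟩ := S.exists_homotopy (drainPush i)
  have hmem : ∀ z, r z ∈ S.stratum i := by
    rintro ⟨_, n, x, a, hx, rfl⟩
    obtain ⟨m, y, ι, h⟩ := S.exists_isSaturationOf x
    rw [hr' x hx a]
    rcases hx.lt_or_eq with hx' | hx'
    · rw [S.flow_eq_pt _ _ _ _ (Or.inl hx')]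
      exact S.pt_mem_stratum (Nat.lt_succ_iff.1 hx') a
    · have hcard : (S.core y).card = i + 1 := by rw [h.core_eq, Finset.card_map, hx']
      have hne : (S.core y)ᶜ.Nonempty := by
        obtain ⟨j, hj⟩ := S.exists_notMem_core h.1
        exact ⟨j, Finset.mem_compl.2 hj⟩
      have hd : (drainPush i).toFun (S.core y) (push ι a) = drain (S.core y) hne (push ι a) :=
        dif_pos ⟨hcard, hne⟩
      rw [S.flow_eq _ h, segment_one, hd]
      obtain ⟨j, hj, hj'⟩ := exists_eq_minCoord (N := S.core y)
        (Finset.card_pos.1 (by omega)) (push ι a)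
      have h0 : drain (S.core y) hne (push ι a) j = 0 := by
        rw [drain_apply, if_pos hj, hj', sub_self]
      -- The drained point lies in a face that misses the vertex `j`.
      obtain ⟨k, κ, b, hb, hpos⟩ := exists_push_eq (drain (S.core y) hne (push ι a))
      have hjκ : j ∉ Set.range κ := by
        rw [mem_range_iff_of_push_eq hb hpos, h0]; simp
      rw [← hb, ← pt_face]
      refine S.pt_mem_stratum ?_ b
      have := S.card_core_face_lt κ y hjκ hj
      omega
  let r' : C(S.stratum (i + 1), S.stratum i) := ⟨fun z => ⟨r z, hmem z⟩, by fun_prop⟩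
  obtain ⟨z, hz⟩ := hi.comp_left r'
  exact ⟨z, hr.trans hz⟩

/-- A symmetric Delta-complex of bounded dimension that has a saturation is contractible. -/
theorem contractibleSpace {X : SymmDeltaComplex} (S : Saturation X) [Nonempty (Simp X 0)]
    [Subsingleton (Simp X 0)] {B : ℕ}
    (hB : ∀ (n : ℕ), Simp X n → n ≤ B) : ContractibleSpace (Realization X) := by
  have h : ∀ i, (S.stratumIncl i).Nullhomotopic := by
    intro i
    induction i with
    | zero => exact S.nullhomotopic_stratumIncl_zero
    | succ i ih => exact S.nullhomotopic_stratumIncl_succ ih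
  have hall : ∀ z, z ∈ S.stratum B := by
    intro z
    obtain ⟨n, x, a, rfl⟩ := exists_pt_eq z
    refine S.pt_mem_stratum (le_trans ?_ (hB n x)) a
    simpa using Finset.card_le_univ (S.core x)
  rw [contractible_iff_id_nullhomotopic]
  exact (h B).comp_left ⟨fun z => ⟨z, hall z⟩, by fun_prop⟩

end Criterion

end Saturation

/-- A complex with a single simplex, of dimension zero, is contractible. -/
theorem contractibleSpace_of_point {X : SymmDeltaComplex} [Nonempty (Simp X 1)]
    [Subsingleton (Simp X 1)] (h : ∀ n, Simp X n → n ≤ 1) :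
    ContractibleSpace (Realization X) := by
  obtain ⟨x₀⟩ := ‹Nonempty (Simp X 1)›
  have huniq : ∀ z : Realization X, z = pt x₀ (Saturation.barycentre one_pos) := by
    intro z
    obtain ⟨n, x, a, rfl⟩ := exists_pt_eq z
    obtain rfl : n = 1 := le_antisymm (h n x) (pos_of_stdSimplex a)
    rw [Subsingleton.elim x x₀, Subsingleton.elim a]
  let _ : Unique (Realization X) := ⟨⟨_⟩, huniq⟩
  infer_instance

end TropicalHassett

namespace TropicalHassett

/-! ### Tails of marked graphs -/

section
open scoped Classical

variable {n : ℕ}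

namespace MarkedGraph

/-- A map on vertices that is constant along the edges of `S` is constant on the components
of `S`. -/
theorem joined_apply_eq {G : MarkedGraph n} {S : Set G.E} {α : Sort*} (φ : G.V → α)
    (h : ∀ e ∈ S, ∀ x y, G.ends e = s(x, y) → φ x = φ y) {u v : G.V} (huv : G.joined S u v) :
    φ u = φ v := by
  change Relation.EqvGen _ u v at huv
  induction huv with
  | rel x y hxy => obtain ⟨e, he, h'⟩ := hxy; exact h e he x y h'
  | refl x => rfl
  | symm x y _ ih => exact ih.symm
  | trans x y z _ _ ih1 ih2 => exact ih1.trans ih2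

theorem exists_edge_of_joined_ne {G : MarkedGraph n} {S : Set G.E} {v v' : G.V}
    (h : G.joined S v v') (hne : v ≠ v') : ∃ e ∈ S, ∃ u, u ≠ v ∧ G.ends e = s(u, v) := by
  by_contra hno
  push Not at hno
  have := joined_apply_eq (· = v) (fun e he x y hxy => ?_) h
  · exact hne ((cast this rfl : v' = v)).symm
  · refine propext ⟨?_, ?_⟩
    · rintro rfl
      by_contra hy
      exact hno e he y hy (by rw [hxy, Sym2.eq_swap])
    · rintro rfl
      by_contra hx
      exact hno e he x hx hxy

/-- The number of half edges of `e` at `v`. -/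
noncomputable def incidence (G : MarkedGraph n) (e : G.E) (v : G.V) : ℕ :=
  (G.ends e).toMultiset.count v

theorem count_toMultiset {α : Type} (a b t : α) : (Sym2.toMultiset s(a, b)).count t =
    (if t = a then 1 else 0) + (if t = b then 1 else 0) := by
  change Multiset.count t (a ::ₘ b ::ₘ 0) = _
  rw [Multiset.count_cons, Multiset.count_cons, Multiset.count_zero]
  omega

theorem incidence_loop {G : MarkedGraph n} {e : G.E} {v : G.V} (h : G.ends e = s(v, v)) :
    G.incidence e v = 2 := by
  rw [incidence, h, count_toMultiset]; simp

theorem incidence_pos {G : MarkedGraph n} {e : G.E} {u v : G.V} (h : G.ends e = s(u, v)) :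
    1 ≤ G.incidence e v := by
  rw [incidence, h, count_toMultiset]; simp

theorem val_eq_sum (G : MarkedGraph n) (v : G.V) : G.val v = ∑ e, G.incidence e v := rfl

theorem sum_incidence_le_val (G : MarkedGraph n) (s : Finset G.E) (v : G.V) :
    ∑ e ∈ s, G.incidence e v ≤ G.val v :=
  Finset.sum_le_sum_of_subset (Finset.subset_univ s)

theorem sum_val (G : MarkedGraph n) : ∑ v, G.val v = 2 * Fintype.card G.E := by
  unfold val
  rw [Finset.sum_comm, mul_comm, ← smul_eq_mul, ← Finset.card_univ, ← Finset.sum_const]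
  refine Finset.sum_congr rfl fun e _ => ?_
  induction G.ends e with
  | h a b => simp [count_toMultiset, Finset.sum_add_distrib]

/-- A vertex with a loop or of positive weight. -/
def IsLW (G : MarkedGraph n) (v : G.V) : Prop := 0 < G.weight v ∨ ∃ e, G.ends e = s(v, v)

/-- A tail: an unmarked vertex that either has weight one and valence one, or has weight zero,
valence three and a loop. -/
def IsTail (G : MarkedGraph n) (v : G.V) : Prop :=
  G.IsLW v ∧ (∀ i, G.mark i ≠ v) ∧ 2 * G.weight v + G.val v = 3

/-- The edge by which a tail is attached. -/
def IsTailEdge (G : MarkedGraph n) (e : G.E) : Prop :=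
  ∃ u t, G.ends e = s(u, t) ∧ u ≠ t ∧ G.IsTail t

/-- All loops and all positive weights are in tails. -/
def IsSaturated (G : MarkedGraph n) : Prop := ∀ v, G.IsLW v → G.IsTail v

theorem hasLoopOrWeight_iff {G : MarkedGraph n} : G.HasLoopOrWeight ↔ ∃ v, G.IsLW v := by
  constructor
  · rintro (⟨e, he⟩ | ⟨v, hv⟩)
    · obtain ⟨⟨x, y⟩, hxy⟩ := Quot.exists_rep (G.ends e)
      have hxy : G.ends e = s(x, y) := hxy.symm
      rw [hxy, Sym2.mk_isDiag_iff] at he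
      subst he
      exact ⟨x, Or.inr ⟨e, hxy⟩⟩
    · exact ⟨v, Or.inl hv⟩
  · rintro ⟨v, hv | ⟨e, he⟩⟩
    · exact Or.inr ⟨v, hv⟩
    · exact Or.inl ⟨e, by rw [he]; exact Sym2.mk_isDiag_iff.2 rfl⟩

/-- A tail is attached by a single edge. -/
theorem IsTail.edge_unique {G : MarkedGraph n} {t u u' : G.V} (ht : G.IsTail t) {e e' : G.E}
    (he : G.ends e = s(u, t)) (hu : u ≠ t) (he' : G.ends e' = s(u', t)) (hu' : u' ≠ t) :
    e = e' := by
  by_contra hne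
  have hi := incidence_pos he
  have hi' := incidence_pos he'
  obtain ⟨hlw, -, hval⟩ := ht
  rcases hlw with hw | ⟨l, hl⟩
  · have := G.sum_incidence_le_val {e, e'} t
    rw [Finset.sum_pair hne] at this
    omega
  · have hloop : ∀ {a : G.E} {b : G.V}, G.ends a = s(b, t) → b ≠ t → l ≠ a := by
      rintro a b h1 h2 rfl
      rw [hl, Sym2.eq_iff] at h1
      rcases h1 with h1 | h1
      · exact h2 h1.1.symm
      · exact h2 h1.2.symm
    have := G.sum_incidence_le_val {l, e, e'} t
    rw [Finset.sum_insert (by simp [hloop he hu, hloop he' hu']), Finset.sum_pair hne,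
      incidence_loop hl] at this
    omega

theorem IsTail.loop_unique {G : MarkedGraph n} {t : G.V} (ht : G.IsTail t) {e e' : G.E}
    (he : G.ends e = s(t, t)) (he' : G.ends e' = s(t, t)) : e = e' := by
  by_contra hne
  have := G.sum_incidence_le_val {e, e'} t
  rw [Finset.sum_pair hne, incidence_loop he, incidence_loop he'] at this
  have := ht.2.2
  omega

theorem IsTail.weight_eq_zero {G : MarkedGraph n} {t : G.V} (ht : G.IsTail t) {e : G.E}
    (he : G.ends e = s(t, t)) : G.weight t = 0 := by
  have := G.sum_incidence_le_val {e} t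
  rw [Finset.sum_singleton, incidence_loop he] at this
  have := ht.2.2
  omega

theorem IsTail.weight_le_one {G : MarkedGraph n} {t : G.V} (ht : G.IsTail t) :
    G.weight t ≤ 1 := by
  have := ht.2.2
  omega

theorem not_isTailEdge_of_loop {G : MarkedGraph n} {v : G.V} {e : G.E}
    (he : G.ends e = s(v, v)) : ¬ G.IsTailEdge e := by
  rintro ⟨u, t, h, hne, -⟩
  rw [he, Sym2.eq_iff] at h
  rcases h with h | h
  · exact hne (h.1.symm.trans h.2)
  · exact hne (h.2.symm.trans h.1)

/-- The contribution `2 h(v) - 2 + val(v)` of a vertex to `2 g - 2`. -/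
noncomputable def excess (G : MarkedGraph n) (v : G.V) : ℤ := 2 * G.weight v - 2 + G.val v

theorem IsTail.excess_eq {G : MarkedGraph n} {t : G.V} (ht : G.IsTail t) : G.excess t = 1 := by
  have := ht.2.2
  unfold excess
  omega

theorem sum_excess (G : MarkedGraph n) : ∑ v, G.excess v = 2 * G.genus - 2 := by
  have h := congrArg (Nat.cast : ℕ → ℤ) G.sum_val
  push_cast at h
  simp only [excess, Finset.sum_add_distrib, Finset.sum_sub_distrib, ← Finset.mul_sum, h,
    Finset.sum_const, Finset.card_univ, nsmul_eq_mul, genus]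
  ring

theorem IsLW.excess_nonneg {G : MarkedGraph n} {v : G.V} (h : G.IsLW v) : 0 ≤ G.excess v := by
  unfold excess
  rcases h with h | ⟨e, he⟩
  · omega
  · have := G.sum_incidence_le_val {e} v
    rw [Finset.sum_singleton, incidence_loop he] at this
    omega

theorem isStable_iff_excess {G : MarkedGraph n} {w : Fin n → ℚ} :
    G.IsStable w ↔ ∀ v, 0 < (G.excess v : ℚ) + ∑ i with G.mark i = v, w i := by
  unfold IsStable excess
  push_cast
  rfl

theorem IsStable.one_le_excess {G : MarkedGraph n} {w : Fin n → ℚ} (hG : G.IsStable w) {v : G.V}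
    (hv : ∀ i, G.mark i ≠ v) : 1 ≤ G.excess v := by
  have h := isStable_iff_excess.1 hG v
  rw [Finset.filter_false_of_mem fun i _ => hv i, Finset.sum_empty, add_zero] at h
  exact_mod_cast h

namespace IsContraction

variable {G H : MarkedGraph n} {f : G.V → H.V} {k : H.E → G.E}

theorem map_eq_of_ends (h : IsContraction G H f k) {e : G.E} (he : e ∉ Set.range k) {u v : G.V}
    (huv : G.ends e = s(u, v)) : f u = f v :=
  (h.fiber u v).2 (joined_of_mem G he huv)

/-- The excess of a vertex is the total excess of its fibre. -/
theorem excess_eq (h : IsContraction G H f k) (c : H.V) :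
    H.excess c = ∑ v ∈ G.vertsOver f c, G.excess v := by
  have h1 := congrArg (Nat.cast : ℕ → ℤ) (h.weight c)
  have h2 := congrArg (Nat.cast : ℕ → ℤ) (h.val_eq c)
  push_cast at h1 h2
  simp only [excess, Finset.sum_add_distrib, Finset.sum_sub_distrib, ← Finset.mul_sum,
    Finset.sum_const, nsmul_eq_mul]
  linarith

/-- In a stable graph nothing can be contracted to a tail. -/
theorem eq_of_isTail (h : IsContraction G H f k) {w : Fin n → ℚ} (hG : G.IsStable w) {c : H.V}
    (hc : H.IsTail c) {u v : G.V} (hu : f u = c) (hv : f v = c) : u = v := by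
  have h1 := h.excess_eq c
  rw [hc.excess_eq] at h1
  have h2 : ((G.vertsOver f c).card : ℤ) ≤ ∑ v ∈ G.vertsOver f c, G.excess v := by
    rw [← nsmul_one, ← Finset.sum_const]
    refine Finset.sum_le_sum fun v hv => hG.one_le_excess fun i hi => hc.2.1 i ?_
    rw [h.mark, hi, (G.mem_vertsOver).1 hv]
  have h3 : (G.vertsOver f c).card ≤ 1 := by omega
  exact Finset.card_le_one.1 h3 u (by simpa using hu) v (by simpa using hv)

/-- A vertex that is not identified with another one is a tail if and only if its image is. -/
theorem isTail_iff (h : IsContraction G H f k) {t : G.V} (ht : ∀ v, f v = f t → v = t) :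
    H.IsTail (f t) ↔ G.IsTail t := by
  have hv : G.vertsOver f (f t) = {t} := by
    ext v
    simp only [mem_vertsOver, Finset.mem_singleton]
    exact ⟨ht v, fun h => by rw [h]⟩
  have hends : ∀ e, (G.ends e).map f = s(f t, f t) ↔ G.ends e = s(t, t) := by
    intro e
    induction G.ends e with
    | h x y =>
      rw [Sym2.map_mk, Sym2.eq_iff, Sym2.eq_iff]
      constructor
      · rintro (⟨h1, h2⟩ | ⟨h1, h2⟩) <;> exact Or.inl ⟨ht _ h1, ht _ h2⟩
      · rintro (⟨rfl, rfl⟩ | ⟨rfl, rfl⟩) <;> exact Or.inl ⟨rfl, rfl⟩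
  have hw := h.weight (f t)
  rw [hv, Finset.card_singleton, Finset.sum_singleton] at hw
  have hex := h.excess_eq (f t)
  rw [hv, Finset.sum_singleton] at hex
  have hlw : H.IsLW (f t) ↔ G.IsLW t := by
    constructor
    · rintro (hp | ⟨e, he⟩)
      · by_cases h0 : 0 < G.weight t
        · exact Or.inl h0
        · obtain ⟨e, he⟩ := Finset.card_pos.1
            (show 0 < (G.edgesOver (Set.range k)ᶜ f (f t)).card by omega)
          exact Or.inr ⟨e, (hends e).1 ((G.mem_edgesOver).1 he).2⟩
      · exact Or.inr ⟨k e, (hends _).1 (by rw [← h.ends, he])⟩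
    · rintro (hp | ⟨e, he⟩)
      · exact Or.inl (by omega)
      · by_cases hr : e ∈ Set.range k
        · obtain ⟨e, rfl⟩ := hr
          exact Or.inr ⟨e, by rw [h.ends, hends, he]⟩
        · have := Finset.card_pos.2
            (show (G.edgesOver (Set.range k)ᶜ f (f t)).Nonempty from
              ⟨e, (G.mem_edgesOver).2 ⟨hr, (hends e).2 he⟩⟩)
          exact Or.inl (by omega)
  have hmark : (∀ i, H.mark i ≠ f t) ↔ ∀ i, G.mark i ≠ t := by
    refine forall_congr' fun i => not_congr ?_
    rw [h.mark]
    exact ⟨ht _, fun h => by rw [h]⟩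
  unfold excess at hex
  unfold IsTail
  rw [hlw, hmark]
  refine and_congr_right fun _ => and_congr_right fun _ => ?_
  omega

/-- A tail whose edge is not contracted is not identified with another vertex. -/
theorem eq_of_map_eq_tail (h : IsContraction G H f k) {u t : G.V} (ht : G.IsTail t) {e : H.E}
    (he : G.ends (k e) = s(u, t)) (hu : u ≠ t) {v : G.V} (hv : f v = f t) : v = t := by
  by_contra hne
  obtain ⟨e', he', u', hu', h'⟩ := exists_edge_of_joined_ne ((h.fiber t v).1 hv.symm) (Ne.symm hne)
  exact he' ⟨e, ht.edge_unique he hu h' hu'⟩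

theorem isTailEdge_iff (h : IsContraction G H f k) {w : Fin n → ℚ} (hG : G.IsStable w) (e : H.E) :
    G.IsTailEdge (k e) ↔ H.IsTailEdge e := by
  constructor
  · rintro ⟨u, t, he, hne, ht⟩
    have hf := fun v => h.eq_of_map_eq_tail ht he hne (v := v)
    refine ⟨f u, f t, by rw [h.ends, he, Sym2.map_mk], fun hut => hne (hf u hut),
      (h.isTail_iff hf).2 ht⟩
  · rintro ⟨a, c, he, hne, hc⟩
    obtain ⟨⟨x, y⟩, hxy⟩ := Quot.exists_rep (G.ends (k e))
    have hxy : G.ends (k e) = s(x, y) := hxy.symm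
    rw [h.ends, hxy, Sym2.map_mk, Sym2.eq_iff] at he
    rcases he with ⟨rfl, rfl⟩ | ⟨rfl, rfl⟩
    · exact ⟨x, y, hxy, fun h => hne (by rw [h]),
        (h.isTail_iff fun v hv => h.eq_of_isTail hG hc hv rfl).1 hc⟩
    · exact ⟨y, x, by rw [hxy, Sym2.eq_swap], fun h => hne (by rw [h]),
        (h.isTail_iff fun v hv => h.eq_of_isTail hG hc hv rfl).1 hc⟩

/-- The contracted part of a fibre is connected. -/
theorem card_vertsOver_le (h : IsContraction G H f k) (c : H.V) :
    (G.vertsOver f c).card ≤ (G.edgesOver (Set.range k)ᶜ f c).card + 1 := by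
  obtain ⟨v, rfl⟩ := h.surj c
  have hq : ∀ u, f u = f v ↔ Quotient.mk (G.joined (Set.range k)ᶜ) u = Quotient.mk _ v := by
    intro u
    rw [h.fiber, Quotient.eq]
  have h1 := (card_fiber_le G (Set.range k)ᶜ (Quotient.mk _ v)).trans
    (Nat.add_le_add_right (Finset.card_le_card (Finset.filter_subset _ _)) 1)
  refine le_of_eq_of_le ?_ (h1.trans (le_of_eq ?_))
  · congr 1
    ext u
    rw [mem_vertsOver, mem_vertsOver, hq]
  · congr 2
    ext e
    rw [mem_edgesOver, mem_edgesOver]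
    refine and_congr_right fun _ => ?_
    induction G.ends e with
    | h x y => simp only [Sym2.map_mk, Sym2.eq_iff, hq]

theorem weight_le (h : IsContraction G H f k) (v : G.V) : G.weight v ≤ H.weight (f v) := by
  have h1 := h.weight (f v)
  have h2 := h.card_vertsOver_le (f v)
  have h3 : G.weight v ≤ ∑ u ∈ G.vertsOver f (f v), G.weight u :=
    Finset.single_le_sum (f := G.weight) (fun _ _ => Nat.zero_le _) (by simp)
  omega

/-- If only tail edges are contracted, then every fibre has more vertices than contracted
edges, since the tails of the contracted edges are distinct and do not exhaust the fibre. -/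
theorem card_edgesOver_lt (h : IsContraction G H f k) (hk : ∀ e ∉ Set.range k, G.IsTailEdge e)
    (c : H.V) : (G.edgesOver (Set.range k)ᶜ f c).card < (G.vertsOver f c).card := by
  have : Nonempty G.V := ⟨(h.surj c).choose⟩
  choose! u t het hut ht using hk
  have hmaps : ∀ e ∈ G.edgesOver (Set.range k)ᶜ f c, f (u e) = c ∧ f (t e) = c := by
    intro e he
    obtain ⟨he, hc⟩ := (G.mem_edgesOver).1 he
    rw [het e he, Sym2.map_mk, Sym2.eq_iff] at hc
    rcases hc with hc | hc <;> exact hc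
  have hinj : Set.InjOn t (G.edgesOver (Set.range k)ᶜ f c) := by
    intro e he e' he' hee
    have he := ((G.mem_edgesOver).1 he).1
    have he' := ((G.mem_edgesOver).1 he').1
    exact (ht e he).edge_unique (het e he) (hut e he) (by rw [het e' he', hee])
      (by rw [hee]; exact hut e' he')
  rw [← Finset.card_image_of_injOn hinj]
  refine Finset.card_lt_card ((Finset.ssubset_iff_of_subset ?_).2 ?_)
  · intro v hv
    obtain ⟨e, he, rfl⟩ := Finset.mem_image.1 hv
    exact (G.mem_vertsOver).2 (hmaps e he).2
  · rcases (G.edgesOver (Set.range k)ᶜ f c).eq_empty_or_nonempty with h0 | ⟨e, he⟩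
    · obtain ⟨v, hv⟩ := h.surj c
      exact ⟨v, by simpa using hv, by simp [h0]⟩
    · refine ⟨u e, (G.mem_vertsOver).2 (hmaps e he).1, fun hmem => ?_⟩
      obtain ⟨e', he', hu⟩ := Finset.mem_image.1 hmem
      have he := ((G.mem_edgesOver).1 he).1
      have he' := ((G.mem_edgesOver).1 he').1
      have hee : e = e' := (ht e' he').edge_unique (u := t e)
        (by rw [het e he, hu, Sym2.eq_swap]) (by rw [hu]; exact (hut e he).symm)
        (het e' he') (hut e' he')
      subst hee
      exact hut e he hu.symm

theorem exists_weight_pos (h : IsContraction G H f k)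
    (hk : ∀ e ∉ Set.range k, G.IsTailEdge e) {c : H.V} (hc : 0 < H.weight c) :
    ∃ v, f v = c ∧ 0 < G.weight v := by
  have h1 := h.weight c
  have h2 := h.card_edgesOver_lt hk c
  obtain ⟨v, hv, h0⟩ := Finset.sum_pos_iff.1
    (show 0 < ∑ v ∈ G.vertsOver f c, G.weight v by omega)
  exact ⟨v, (G.mem_vertsOver).1 hv, h0⟩

/-- Contracting tail edges creates no new loops: the contracted edges over a vertex form a star,
and an edge between different vertices of a star would give a tail a second edge. -/
theorem exists_loop (h : IsContraction G H f k) (hk : ∀ e ∉ Set.range k, G.IsTailEdge e) {c : H.V}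
    {e : H.E} (he : H.ends e = s(c, c)) : ∃ v, f v = c ∧ G.ends (k e) = s(v, v) := by
  have : Nonempty G.V := ⟨(h.surj c).choose⟩
  choose! u t het hut ht using hk
  obtain ⟨⟨a, b⟩, hab⟩ := Quot.exists_rep (G.ends (k e))
  have hab : G.ends (k e) = s(a, b) := hab.symm
  have hfab : f a = c ∧ f b = c := by
    rw [h.ends, hab, Sym2.map_mk, Sym2.eq_iff] at he
    rcases he with he | he <;> exact he
  refine ⟨a, hfab.1, ?_⟩
  by_cases hne : a = b
  · rw [hab, hne]
  exfalso
  have ha : ∀ e' ∉ Set.range k, t e' ≠ a := by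
    rintro e' he' rfl
    exact he' ⟨e, (ht e' he').edge_unique (by rw [hab, Sym2.eq_swap]) (Ne.symm hne) (het e' he')
      (hut e' he')⟩
  have hb : ∀ e' ∉ Set.range k, t e' ≠ b := by
    rintro e' he' rfl
    exact he' ⟨e, (ht e' he').edge_unique hab hne (het e' he') (hut e' he')⟩
  -- The star with centre `a` that the contracted edges form.
  let P : G.V → Prop := fun v => v = a ∨ ∃ e' ∉ Set.range k, t e' = v ∧ u e' = a
  have hP : ∀ e' ∉ Set.range k, P (u e') ↔ P (t e') := by
    intro e' he'
    constructor
    · rintro (h1 | ⟨e'', he'', h1, h2⟩)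
      · exact Or.inr ⟨e', he', rfl, h1⟩
      · have : e' = e'' := (ht e'' he'').edge_unique (u := t e')
          (by rw [het e' he', h1, Sym2.eq_swap]) (by rw [h1]; exact (hut e' he').symm)
          (het e'' he'') (hut e'' he'')
        subst this
        exact absurd h1.symm (hut e' he')
    · rintro (h1 | ⟨e'', he'', h1, h2⟩)
      · exact absurd h1 (ha e' he')
      · have : e' = e'' := (ht e'' he'').edge_unique (u := u e') (by rw [het e' he', h1])
          (by rw [h1]; exact hut e' he') (het e'' he'') (hut e'' he'')
        subst this
        exact Or.inl h2
  have hPab := joined_apply_eq P (fun e' he' x y hxy => ?_)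
    ((h.fiber a b).1 (hfab.1.trans hfab.2.symm))
  · have : P b := hPab ▸ Or.inl rfl
    rcases this with h1 | ⟨e', he', h1, -⟩
    · exact hne h1.symm
    · exact hb e' he' h1
  · rw [het e' he', Sym2.eq_iff] at hxy
    rcases hxy with ⟨rfl, rfl⟩ | ⟨rfl, rfl⟩
    · exact propext (hP e' he')
    · exact propext (hP e' he').symm

end IsContraction

end MarkedGraph

end

end TropicalHassett

namespace TropicalHassett

/-! ### Pulling out a tail -/

section
open scoped Classical

variable {n : ℕ}

namespace MarkedGraph

/-- A choice of a feature at the vertex `v` that can be moved to a new tail: the value `none`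
stands for a unit of weight, and `some e` for the loop `e`. -/
def CanPull (G : MarkedGraph n) (v : G.V) (l : Option G.E) : Prop :=
  (l = none → 0 < G.weight v) ∧ ∀ e, l = some e → G.ends e = s(v, v)

theorem isLW_iff_canPull {G : MarkedGraph n} {v : G.V} : G.IsLW v ↔ ∃ l, G.CanPull v l := by
  constructor
  · rintro (h | ⟨e, he⟩)
    · exact ⟨none, fun _ => h, by simp⟩
    · exact ⟨some e, by simp, fun e' he' => by rw [← Option.some.inj he', he]⟩
  · rintro ⟨_ | e, h1, h2⟩
    · exact Or.inl (h1 rfl)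
    · exact Or.inr ⟨e, h2 e rfl⟩

/-- Attach a new vertex to `v` by a new edge (both called `none`), and move to the new vertex a
unit of weight or a loop at `v`. -/
noncomputable def pull (G : MarkedGraph n) (v : G.V) (l : Option G.E) : MarkedGraph n where
  V := Option G.V
  E := Option G.E
  ends
    | none => s(some v, none)
    | some e => if l = some e then s(none, none) else (G.ends e).map some
  mark i := some (G.mark i)
  weight
    | none => if l = none then 1 else 0
    | some u => G.weight u - if u = v ∧ l = none then 1 else 0

/-- The vertex of `G.pull v l` at the end of the new tail. -/
def pullNewV (G : MarkedGraph n) (v : G.V) (l : Option G.E) : (G.pull v l).V :=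
  (none : Option G.V)

/-- The vertices of `G` as vertices of `G.pull v l`. -/
def pullOldV (G : MarkedGraph n) (v : G.V) (l : Option G.E) (u : G.V) : (G.pull v l).V :=
  some u

/-- The edge of `G.pull v l` to the new tail. -/
def pullNewE (G : MarkedGraph n) (v : G.V) (l : Option G.E) : (G.pull v l).E :=
  (none : Option G.E)

/-- The edges of `G` as edges of `G.pull v l`. -/
def pullOldE (G : MarkedGraph n) (v : G.V) (l : Option G.E) (e : G.E) : (G.pull v l).E :=
  some e

/-- The map on vertices that contracts the new edge. -/
def pullToV (G : MarkedGraph n) (v : G.V) (l : Option G.E) : (G.pull v l).V → G.V :=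
  fun a : Option G.V => a.getD v

/-- The map on the edges of `G.pull v l` given by a map on the edges of `G` and an image of the
new edge. -/
def pullElimE (G : MarkedGraph n) (v : G.V) (l : Option G.E) {E : Type} (e₀ : E) (k : G.E → E) :
    (G.pull v l).E → E :=
  fun e : Option G.E => e.elim e₀ k

section Api

variable (G : MarkedGraph n) (v : G.V) (l : Option G.E)

theorem pull_V_cases (a : (G.pull v l).V) : a = G.pullNewV v l ∨ ∃ u, a = G.pullOldV v l u := by
  rcases (a : Option G.V) with _ | u
  · exact Or.inl rfl
  · exact Or.inr ⟨u, rfl⟩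

theorem pull_E_cases (a : (G.pull v l).E) : a = G.pullNewE v l ∨ ∃ e, a = G.pullOldE v l e := by
  rcases (a : Option G.E) with _ | u
  · exact Or.inl rfl
  · exact Or.inr ⟨u, rfl⟩

theorem pullOldV_inj {u u' : G.V} : G.pullOldV v l u = G.pullOldV v l u' ↔ u = u' :=
  Option.some_inj

theorem pullOldE_injective : Function.Injective (G.pullOldE v l) := Option.some_injective _

theorem pullOldV_ne (u : G.V) : G.pullOldV v l u ≠ G.pullNewV v l := Option.some_ne_none u

theorem pullOldE_ne (e : G.E) : G.pullOldE v l e ≠ G.pullNewE v l := Option.some_ne_none e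

theorem notMem_range_pullOldE {e : (G.pull v l).E} :
    e ∉ Set.range (G.pullOldE v l) ↔ e = G.pullNewE v l := by
  constructor
  · intro h
    rcases G.pull_E_cases v l e with h' | ⟨e, rfl⟩
    · exact h'
    · exact absurd ⟨e, rfl⟩ h
  · rintro rfl ⟨e, he⟩
    exact G.pullOldE_ne v l e he

theorem pull_ends_new : (G.pull v l).ends (G.pullNewE v l) =
    s(G.pullOldV v l v, G.pullNewV v l) := rfl

theorem pull_ends_of_ne {e : G.E} (h : l ≠ some e) :
    (G.pull v l).ends (G.pullOldE v l e) = (G.ends e).map (G.pullOldV v l) := if_neg h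

theorem pull_ends_of_eq {e : G.E} (h : l = some e) :
    (G.pull v l).ends (G.pullOldE v l e) = s(G.pullNewV v l, G.pullNewV v l) := if_pos h

theorem pull_mark (i : Fin n) : (G.pull v l).mark i = G.pullOldV v l (G.mark i) := rfl

theorem pull_weight_new : (G.pull v l).weight (G.pullNewV v l) = if l = none then 1 else 0 := rfl

theorem pull_weight_old (u : G.V) : (G.pull v l).weight (G.pullOldV v l u) =
    G.weight u - if u = v ∧ l = none then 1 else 0 := rfl

theorem pullToV_new : G.pullToV v l (G.pullNewV v l) = v := rfl

theorem pullToV_old (u : G.V) : G.pullToV v l (G.pullOldV v l u) = u := rfl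

theorem pullElimE_new {E : Type} (e₀ : E) (k : G.E → E) :
    G.pullElimE v l e₀ k (G.pullNewE v l) = e₀ := rfl

theorem pullElimE_old {E : Type} (e₀ : E) (k : G.E → E) (e : G.E) :
    G.pullElimE v l e₀ k (G.pullOldE v l e) = k e := rfl

theorem vertsOver_pullToV_self :
    (G.pull v l).vertsOver (G.pullToV v l) v = {G.pullOldV v l v, G.pullNewV v l} := by
  ext a
  rw [mem_vertsOver, Finset.mem_insert, Finset.mem_singleton]
  rcases G.pull_V_cases v l a with rfl | ⟨u, rfl⟩
  · simp [pullToV_new]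
  · simp [pullToV_old, pullOldV_inj, pullOldV_ne]

theorem vertsOver_pullToV_of_ne {c : G.V} (hc : c ≠ v) :
    (G.pull v l).vertsOver (G.pullToV v l) c = {G.pullOldV v l c} := by
  ext a
  rw [mem_vertsOver, Finset.mem_singleton]
  rcases G.pull_V_cases v l a with rfl | ⟨u, rfl⟩
  · simp [pullToV_new, Ne.symm hc, Ne.symm (G.pullOldV_ne v l c)]
  · simp [pullToV_old, pullOldV_inj]

end Api

/-- A graph `G` that is contracted to `H`, such that the edge of the tail `t` of `G` is among the
contracted edges, is also contracted to the graph that arises from `H` by pulling out a tail. -/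
theorem IsContraction.pull {G H : MarkedGraph n} {f : G.V → H.V} {k : H.E → G.E}
    (h : IsContraction G H f k) {t u : G.V} (ht : G.IsTail t) {e₀ : G.E}
    (he₀ : G.ends e₀ = s(u, t)) (hut : u ≠ t) (hr : e₀ ∉ Set.range k) {l : Option H.E}
    (hl0 : l = none → 0 < G.weight t) (hl : ∀ e, l = some e → G.ends (k e) = s(t, t)) :
    IsContraction G (H.pull (f t) l)
      (fun v => if v = t then H.pullNewV (f t) l else H.pullOldV (f t) l (f v))
      (H.pullElimE (f t) l e₀ k) := by
  have hfu : f u = f t := h.map_eq_of_ends hr he₀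
  -- An edge at the tail is the loop that is pulled out or the edge of the tail.
  have hloop : ∀ e x, G.ends e = s(x, t) → e ≠ e₀ → x = t := by
    intro e x he hne
    by_contra hx
    exact hne (ht.edge_unique he hx he₀ hut)
  have hk0 : ∀ e, k e ≠ e₀ := fun e he => hr ⟨e, he⟩
  have hloop2 : ∀ e, G.ends e = s(t, t) → ∃ e', l = some e' ∧ e = k e' := by
    intro e he
    rcases l with _ | e'
    · have := hl0 rfl
      have := ht.weight_eq_zero he
      omega
    · exact ⟨e', rfl, ht.loop_unique he (hl e' rfl)⟩
  have hw : G.weight t = if l = none then 1 else 0 := by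
    split_ifs with hl'
    · have := hl0 hl'
      have := ht.weight_le_one
      omega
    · obtain ⟨e, he⟩ := Option.ne_none_iff_exists'.1 hl'
      exact ht.weight_eq_zero (hl e he)
  have hrange : ∀ e, e ∉ Set.range (H.pullElimE (f t) l e₀ k) ↔
      e ∉ Set.range k ∧ e ≠ e₀ := by
    intro e
    constructor
    · intro he
      refine ⟨?_, ?_⟩
      · rintro ⟨e', rfl⟩
        exact he ⟨H.pullOldE (f t) l e', rfl⟩
      · rintro rfl
        exact he ⟨H.pullNewE (f t) l, rfl⟩
    · rintro ⟨h1, h2⟩ ⟨e', rfl⟩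
      rcases H.pull_E_cases (f t) l e' with rfl | ⟨e', rfl⟩
      · exact h2 rfl
      · exact h1 ⟨e', rfl⟩
  -- Contracted edges other than `e₀` do not meet the tail.
  have hnt : ∀ e x y, e ∉ Set.range k → e ≠ e₀ → G.ends e = s(x, y) → y ≠ t := by
    rintro e x y he hne hxy rfl
    obtain rfl := hloop e x hxy hne
    obtain ⟨e', -, rfl⟩ := hloop2 e hxy
    exact he ⟨e', rfl⟩
  let f' : G.V → (H.pull (f t) l).V :=
    fun v => if v = t then H.pullNewV (f t) l else H.pullOldV (f t) l (f v)
  have hf't : f' t = H.pullNewV (f t) l := if_pos rfl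
  have hf' : ∀ {v}, v ≠ t → f' v = H.pullOldV (f t) l (f v) := fun hv => if_neg hv
  have hf'none : ∀ v, f' v = H.pullNewV (f t) l ↔ v = t := by
    intro v
    by_cases hv : v = t <;> simp [f', hv, pullOldV_ne]
  have hf'some : ∀ v a, f' v = H.pullOldV (f t) l a ↔ v ≠ t ∧ f v = a := by
    intro v a
    by_cases hv : v = t <;> simp [f', hv, pullOldV_inj, (H.pullOldV_ne (f t) l a).symm]
  refine ⟨?_, ?_, ?_, ?_, ?_, ?_⟩
  · intro a
    rcases H.pull_V_cases (f t) l a with rfl | ⟨a, rfl⟩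
    · exact ⟨t, hf't⟩
    · obtain ⟨v, rfl⟩ := h.surj a
      by_cases hv : v = t
      · exact ⟨u, by rw [hv, ← hfu]; exact hf' hut⟩
      · exact ⟨v, hf' hv⟩
  · intro e e' hee
    rcases H.pull_E_cases (f t) l e with rfl | ⟨e, rfl⟩ <;>
      rcases H.pull_E_cases (f t) l e' with rfl | ⟨e', rfl⟩
    · rfl
    · exact absurd hee.symm (hk0 e')
    · exact absurd hee (hk0 e)
    · exact congrArg _ (h.inj hee)
  · intro e
    rcases H.pull_E_cases (f t) l e with rfl | ⟨e, rfl⟩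
    · change _ = (G.ends e₀).map f'
      rw [he₀, Sym2.map_mk, hf't, hf' hut, hfu, pull_ends_new]
    · change _ = (G.ends (k e)).map f'
      by_cases hle : l = some e
      · rw [hl e hle, Sym2.map_mk, hf't, pull_ends_of_eq _ _ _ hle]
      · rw [pull_ends_of_ne _ _ _ hle, h.ends]
        obtain ⟨⟨x, y⟩, hxy⟩ := Quot.exists_rep (G.ends (k e))
        have hxy : G.ends (k e) = s(x, y) := hxy.symm
        have hne : ∀ x y, G.ends (k e) = s(x, y) → y ≠ t := by
          rintro x y hxy rfl
          obtain rfl := hloop _ x hxy (hk0 e)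
          obtain ⟨e', he', hke⟩ := hloop2 _ hxy
          exact hle (by rw [he', h.inj hke])
        rw [hxy, Sym2.map_mk, Sym2.map_mk, Sym2.map_mk, hf' (hne x y hxy),
          hf' (hne y x (by rw [hxy, Sym2.eq_swap]))]
  · intro i
    change _ = f' (G.mark i)
    rw [hf' (ht.2.1 i), pull_mark, h.mark]
  · intro a b
    change f' a = f' b ↔ _
    constructor
    · -- A path of contracted edges is moved off the tail.
      let r : G.V → G.V := fun v => if v = t then u else v
      have hr1 : ∀ {v}, v ≠ t → r v = v := fun hv => if_neg hv
      have hrt : r t = u := if_pos rfl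
      have hmove : ∀ a b, G.joined (Set.range k)ᶜ a b →
          G.joined (Set.range (H.pullElimE (f t) l e₀ k))ᶜ (r a) (r b) := by
        intro a b hab
        rw [← Quotient.eq]
        refine joined_apply_eq (fun v => Quotient.mk
          (G.joined (Set.range (H.pullElimE (f t) l e₀ k))ᶜ) (r v)) ?_ hab
        intro e he x y hxy
        by_cases hee : e = e₀
        · rw [hee, he₀, Sym2.eq_iff] at hxy
          rcases hxy with ⟨rfl, rfl⟩ | ⟨rfl, rfl⟩ <;> rw [hrt, hr1 hut]
        · have hy := hnt e x y he hee hxy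
          have hx := hnt e y x he hee (by rw [hxy, Sym2.eq_swap])
          rw [hr1 hx, hr1 hy]
          exact Quotient.sound (joined_of_mem G ((hrange e).2 ⟨he, hee⟩) hxy)
      intro hab
      by_cases ha : a = t
      · rw [ha, hf't, eq_comm, hf'none] at hab
        rw [ha, hab]
      · rw [hf' ha, eq_comm, hf'some] at hab
        have := hmove a b ((h.fiber a b).1 hab.2.symm)
        rwa [hr1 ha, hr1 hab.1] at this
    · intro hab
      refine joined_apply_eq f' ?_ hab
      intro e he x y hxy
      obtain ⟨he, hee⟩ := (hrange e).1 he
      rw [hf' (hnt e x y he hee hxy), hf' (hnt e y x he hee (by rw [hxy, Sym2.eq_swap])),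
        h.map_eq_of_ends he hxy]
  · change ∀ c, _ + (G.vertsOver f' c).card = ∑ v ∈ G.vertsOver f' c, G.weight v +
      (G.edgesOver _ f' c).card + 1
    intro a
    rcases H.pull_V_cases (f t) l a with rfl | ⟨a, rfl⟩
    · have h1 : G.vertsOver f' (H.pullNewV (f t) l) = {t} := by
        ext v; simp [hf'none]
      have h2 : G.edgesOver (Set.range (H.pullElimE (f t) l e₀ k))ᶜ f' (H.pullNewV (f t) l) = ∅ := by
        ext e
        rw [mem_edgesOver]
        simp only [Finset.notMem_empty, iff_false, not_and]
        intro he hmap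
        obtain ⟨he, hee⟩ := (hrange e).1 he
        obtain ⟨⟨x, y⟩, hxy⟩ := Quot.exists_rep (G.ends e)
        have hxy : G.ends e = s(x, y) := hxy.symm
        rw [hxy, Sym2.map_mk, Sym2.eq_iff] at hmap
        refine hnt e x y he hee hxy ((hf'none y).1 ?_)
        rcases hmap with hm | hm <;> exact hm.2
      rw [pull_weight_new, h1, h2, Finset.card_singleton, Finset.sum_singleton, hw, Finset.card_empty]
    · have hmem : ∀ e, e ∈ G.edgesOver (Set.range (H.pullElimE (f t) l e₀ k))ᶜ f'
          (H.pullOldV (f t) l a) ↔ e ∈ G.edgesOver (Set.range k)ᶜ f a ∧ e ≠ e₀ := by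
        intro e
        rw [mem_edgesOver, mem_edgesOver]
        have key : e ∉ Set.range k → e ≠ e₀ →
            ((G.ends e).map f' = s(H.pullOldV (f t) l a, H.pullOldV (f t) l a) ↔ (G.ends e).map f = s(a, a)) := by
          intro he hee
          obtain ⟨⟨x, y⟩, hxy⟩ := Quot.exists_rep (G.ends e)
          have hxy : G.ends e = s(x, y) := hxy.symm
          rw [hxy, Sym2.map_mk, Sym2.map_mk, hf' (hnt e x y he hee hxy),
            hf' (hnt e y x he hee (by rw [hxy, Sym2.eq_swap]))]
          simp [pullOldV_inj]
        constructor
        · rintro ⟨he, hm⟩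
          obtain ⟨he, hee⟩ := (hrange e).1 he
          exact ⟨⟨he, (key he hee).1 hm⟩, hee⟩
        · rintro ⟨⟨he, hm⟩, hee⟩
          exact ⟨(hrange e).2 ⟨he, hee⟩, (key he hee).2 hm⟩
      have hH := h.weight a
      rw [pull_weight_old]
      by_cases ha : a = f t
      · subst ha
        have h1 : G.vertsOver f (f t) = insert t (G.vertsOver f' (H.pullOldV (f t) l (f t))) := by
          ext v
          rw [mem_vertsOver, Finset.mem_insert, mem_vertsOver, hf'some]
          by_cases hv : v = t <;> simp [hv]
        have h2 : G.edgesOver (Set.range k)ᶜ f (f t) = insert e₀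
            (G.edgesOver (Set.range (H.pullElimE (f t) l e₀ k))ᶜ f' (H.pullOldV (f t) l (f t))) := by
          ext e
          rw [Finset.mem_insert, hmem]
          by_cases he : e = e₀
          · subst he
            simp only [true_or, iff_true, mem_edgesOver]
            exact ⟨hr, by rw [he₀, Sym2.map_mk, hfu]⟩
          · simp [he]
        have h1' : t ∉ G.vertsOver f' (H.pullOldV (f t) l (f t)) := by simp [hf'some]
        have h2' : e₀ ∉ G.edgesOver (Set.range (H.pullElimE (f t) l e₀ k))ᶜ f'
            (H.pullOldV (f t) l (f t)) := by
          rw [hmem]; simp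
        have hle := h.weight_le t
        rw [h1, h2, Finset.card_insert_of_notMem h1', Finset.card_insert_of_notMem h2',
          Finset.sum_insert h1'] at hH
        simp only [true_and]
        split_ifs at hw ⊢ <;> omega
      · have h1 : G.vertsOver f' (H.pullOldV (f t) l a) = G.vertsOver f a := by
          ext v
          rw [mem_vertsOver, mem_vertsOver, hf'some]
          refine ⟨fun hv => hv.2, fun hv => ⟨?_, hv⟩⟩
          rintro rfl
          exact ha hv.symm
        have h2 : G.edgesOver (Set.range (H.pullElimE (f t) l e₀ k))ᶜ f' (H.pullOldV (f t) l a) =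
            G.edgesOver (Set.range k)ᶜ f a := by
          ext e
          rw [hmem]
          refine ⟨fun he => he.1, fun he => ⟨he, ?_⟩⟩
          rintro rfl
          have := ((G.mem_edgesOver).1 he).2
          rw [he₀, Sym2.map_mk, hfu, Sym2.eq_iff] at this
          rcases this with hh | hh <;> exact ha hh.1.symm
        rw [h1, h2, if_neg fun hh => ha hh.1]
        omega

section Pull

variable {G : MarkedGraph n} {v : G.V} {l : Option G.E}

/-- Contracting the edge of a tail that has been pulled out undoes the pulling. -/
theorem pull_isContraction (h : G.CanPull v l) :
    IsContraction (G.pull v l) G (G.pullToV v l) (G.pullOldE v l) := by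
  have hedge : ∀ c, (G.pull v l).edgesOver (Set.range (G.pullOldE v l))ᶜ (G.pullToV v l) c =
      if c = v then {G.pullNewE v l} else ∅ := by
    intro c
    ext e
    rw [mem_edgesOver, Set.mem_compl_iff, notMem_range_pullOldE]
    have h0 : ((G.pull v l).ends (G.pullNewE v l)).map (G.pullToV v l) = s(v, v) := by
      rw [pull_ends_new, Sym2.map_mk, pullToV_old, pullToV_new]
    split_ifs with hc
    · rw [Finset.mem_singleton]
      refine ⟨fun he => he.1, ?_⟩
      rintro rfl
      exact ⟨rfl, by rw [h0, hc]⟩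
    · simp only [Finset.notMem_empty, iff_false, not_and]
      rintro rfl hm
      rw [h0, Sym2.eq_iff] at hm
      rcases hm with hm | hm <;> exact hc hm.1.symm
  refine ⟨fun a => ⟨G.pullOldV v l a, rfl⟩, G.pullOldE_injective v l, ?_, fun i => rfl, ?_, ?_⟩
  · intro e
    by_cases hl : l = some e
    · rw [pull_ends_of_eq _ _ _ hl, Sym2.map_mk, h.2 e hl, pullToV_new]
    · rw [pull_ends_of_ne _ _ _ hl, Sym2.map_map]
      exact (congrFun (Sym2.map_id (α := G.V)) _).symm
  · intro a b
    constructor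
    · have key : ∀ a, (G.pull v l).joined (Set.range (G.pullOldE v l))ᶜ a
          (G.pullOldV v l (G.pullToV v l a)) := by
        intro a
        rcases G.pull_V_cases v l a with rfl | ⟨a, rfl⟩
        · exact Setoid.symm' _ (joined_of_mem _ ((G.notMem_range_pullOldE v l).2 rfl)
            (G.pull_ends_new v l))
        · exact Setoid.refl' _ _
      intro hab
      refine Setoid.trans' _ (key a) ?_
      rw [hab]
      exact Setoid.symm' _ (key b)
    · intro hab
      refine joined_apply_eq (G.pullToV v l) ?_ hab
      intro e he x y hxy
      obtain rfl := (G.notMem_range_pullOldE v l).1 he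
      rw [pull_ends_new, Sym2.eq_iff] at hxy
      rcases hxy with ⟨rfl, rfl⟩ | ⟨rfl, rfl⟩ <;> rfl
  · intro c
    rw [hedge]
    by_cases hc : c = v
    · subst hc
      have hne := G.pullOldV_ne c l c
      rw [vertsOver_pullToV_self, if_pos rfl, Finset.card_pair hne, Finset.sum_pair hne,
        Finset.card_singleton, pull_weight_new, pull_weight_old]
      by_cases hl : l = none
      · have := h.1 hl
        simp only [hl, and_self, if_true]
        omega
      · simp [hl]
    · rw [vertsOver_pullToV_of_ne _ _ _ hc, if_neg hc, Finset.card_singleton,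
        Finset.sum_singleton, pull_weight_old, if_neg fun hh => hc hh.1, Finset.card_empty]
      rfl

variable (G v) in
theorem isTail_pull (l : Option G.E) : (G.pull v l).IsTail (G.pullNewV v l) := by
  have hnew : (G.pull v l).incidence (G.pullNewE v l) (G.pullNewV v l) = 1 := by
    rw [incidence, pull_ends_new, count_toMultiset, if_neg (G.pullOldV_ne v l v).symm, if_pos rfl]
  have hold : ∀ e : G.E, (G.pull v l).incidence (G.pullOldE v l e) (G.pullNewV v l) =
      if l = some e then 2 else 0 := by
    intro e
    split_ifs with hl
    · rw [incidence_loop (G.pull_ends_of_eq v l hl)]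
    · rw [incidence, pull_ends_of_ne _ _ _ hl]
      induction G.ends e with
      | h x y =>
        rw [Sym2.map_mk, count_toMultiset, if_neg (G.pullOldV_ne v l x).symm,
          if_neg (G.pullOldV_ne v l y).symm]
  have hval : (G.pull v l).val (G.pullNewV v l) = 1 + ∑ e, if l = some e then 2 else 0 := by
    have huniv : (Finset.univ : Finset (G.pull v l).E) =
        insert (G.pullNewE v l) (Finset.univ.image (G.pullOldE v l)) := by
      ext e
      rcases G.pull_E_cases v l e with rfl | ⟨e, rfl⟩ <;> simp
    rw [val_eq_sum, huniv, Finset.sum_insert, hnew,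
      Finset.sum_image fun _ _ _ _ h => G.pullOldE_injective v l h]
    · simp only [hold]
    · simp [pullOldE_ne]
  refine ⟨?_, fun i hi => G.pullOldV_ne v l _ hi, ?_⟩
  · rcases l with _ | e
    · exact Or.inl Nat.one_pos
    · exact Or.inr ⟨_, G.pull_ends_of_eq v (some e) rfl⟩
  · rw [hval, pull_weight_new]
    rcases l with _ | e <;> simp

variable (G v l) in
theorem isTailEdge_pull : (G.pull v l).IsTailEdge (G.pullNewE v l) :=
  ⟨_, _, G.pull_ends_new v l, G.pullOldV_ne v l v, G.isTail_pull v l⟩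

/-- A vertex of excess zero with a loop or a weight is the only vertex of a connected graph. -/
theorem IsLW.eq_of_excess_eq_zero (hG : G.IsConnected) (hlw : G.IsLW v) (he : G.excess v = 0)
    (x : G.V) : x = v := by
  have key : ∀ e x, G.ends e = s(x, v) → x = v := by
    intro e x hx
    by_contra hne
    have hi := incidence_pos hx
    unfold excess at he
    rcases hlw with hp | ⟨e', he'⟩
    · have := G.sum_incidence_le_val {e} v
      rw [Finset.sum_singleton] at this
      omega
    · have hee : e ≠ e' := by
        rintro rfl
        rw [hx, Sym2.eq_iff] at he'
        rcases he' with hh | hh <;> exact hne hh.1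
      have := G.sum_incidence_le_val {e, e'} v
      rw [Finset.sum_pair hee, incidence_loop he'] at this
      omega
  by_contra hne
  obtain ⟨e, -, u, hu, h⟩ := exists_edge_of_joined_ne (hG.2 v x) (Ne.symm hne)
  exact hu (key e u h)

/-- A tail can be pulled out at any vertex that is not a tail itself, unless the genus is one and
the markings are too light. Pulling lowers the excess of the vertex by one, so only vertices of
excess at most one are at risk; those of excess one carry a marking if they are not tails. -/
theorem inGamma_pull {g : ℕ} {w : Fin n → ℚ} (hw : ∀ i, 0 < w i)
    (hgw : ¬ (g = 1 ∧ ∑ i, w i ≤ 1)) (hG : G.InGamma g w) (h : G.CanPull v l)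
    (hv : ¬ G.IsTail v) : (G.pull v l).InGamma g w := by
  have hc := pull_isContraction h
  have hlw : G.IsLW v := isLW_iff_canPull.2 ⟨l, h⟩
  have hexc : ∀ u : G.V, (G.pull v l).excess (G.pullOldV v l u) =
      G.excess u - if u = v then 1 else 0 := by
    intro u
    have h1 := hc.excess_eq u
    split_ifs with hu
    · subst hu
      rw [vertsOver_pullToV_self, Finset.sum_pair (G.pullOldV_ne u l u),
        (G.isTail_pull u l).excess_eq] at h1
      rw [h1]; ring
    · rw [vertsOver_pullToV_of_ne _ _ _ hu, Finset.sum_singleton] at h1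
      rw [h1]; ring
  have hmarks : ∀ u : G.V, ∑ i with (G.pull v l).mark i = G.pullOldV v l u, w i =
      ∑ i with G.mark i = u, w i := by
    intro u
    refine Finset.sum_congr ?_ fun _ _ => rfl
    ext i
    simp only [Finset.mem_filter, Finset.mem_univ, true_and, pull_mark, pullOldV_inj]
  have hstab := isStable_iff_excess.1 hG.2.1
  refine ⟨⟨⟨G.pullNewV v l⟩, fun a b => hc.joined_lift (Set.subset_univ _) (fun _ _ => trivial)
    (hG.1.2 _ _) a b rfl rfl⟩, isStable_iff_excess.2 ?_, hc.genus_eq.symm.trans hG.2.2⟩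
  intro a
  rcases G.pull_V_cases v l a with rfl | ⟨u, rfl⟩
  · have ht := G.isTail_pull v l
    rw [ht.excess_eq, Finset.filter_false_of_mem fun i _ => ht.2.1 i]
    norm_num
  · rw [hexc, hmarks]
    by_cases hu : u = v
    swap
    · rw [if_neg hu, sub_zero]
      exact hstab u
    subst hu
    rw [if_pos rfl]
    have h0 : 0 ≤ ∑ i with G.mark i = u, w i := Finset.sum_nonneg fun i _ => (hw i).le
    have hcases : G.excess u = 0 ∨ G.excess u = 1 ∨ 2 ≤ G.excess u := by
      have := hlw.excess_nonneg
      omega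
    rcases hcases with he | he | he
    · have huniq := hlw.eq_of_excess_eq_zero hG.1 he
      have hsum := G.sum_excess
      rw [Finset.sum_eq_single u (fun x _ hx => absurd (huniq x) hx) (by simp), he,
        hG.2.2] at hsum
      have hW : 1 < ∑ i, w i := by
        by_contra hle
        exact hgw ⟨by omega, not_lt.1 hle⟩
      rw [Finset.filter_true_of_mem fun i _ => huniq _, he]
      push_cast
      linarith
    · have hmark : ∃ i, G.mark i = u := by
        by_contra hno
        push Not at hno
        refine hv ⟨hlw, hno, ?_⟩
        unfold excess at he
        omega
      obtain ⟨i, hi⟩ := hmark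
      have : 0 < ∑ i with G.mark i = u, w i :=
        Finset.sum_pos (fun i _ => hw i) ⟨i, by simpa using hi⟩
      rw [he]
      push_cast
      linarith
    · have : (2 : ℚ) ≤ G.excess u := by exact_mod_cast he
      push_cast
      linarith

end Pull

/-- Stable graphs of fixed genus have a bounded number of edges: since markings weigh at most one,
the excess of a vertex plus its number of markings is a positive integer, and these sum up to
`2 g - 2 + n`. -/
theorem InGamma.card_edges_le {G : MarkedGraph n} {g : ℕ} {w : Fin n → ℚ} (hw : ∀ i, w i ≤ 1)
    (hG : G.InGamma g w) : Fintype.card G.E ≤ 3 * g + n := by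
  have h1 : ∀ v, (1 : ℤ) ≤ G.excess v + (Finset.univ.filter fun i => G.mark i = v).card := by
    intro v
    have h := isStable_iff_excess.1 hG.2.1 v
    have h2 : ∑ i with G.mark i = v, w i ≤ (Finset.univ.filter fun i => G.mark i = v).card := by
      rw [← nsmul_one, ← Finset.sum_const]
      exact Finset.sum_le_sum fun i _ => hw i
    have : (0 : ℚ) < ((G.excess v + (Finset.univ.filter fun i => G.mark i = v).card : ℤ) : ℚ) := by
      push_cast
      linarith
    have : 0 < G.excess v + (Finset.univ.filter fun i => G.mark i = v).card := by
      exact_mod_cast this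
    omega
  have h2 := Finset.sum_le_sum fun v (_ : v ∈ Finset.univ) => h1 v
  have h3 : ∑ v, (Finset.univ.filter fun i => G.mark i = v).card = n := by
    have := Finset.card_eq_sum_card_fiberwise (f := G.mark) (s := Finset.univ) (t := Finset.univ)
      fun _ _ => Finset.mem_coe.2 (Finset.mem_univ _)
    rw [← this, Finset.card_univ, Fintype.card_fin]
  rw [Finset.sum_add_distrib, sum_excess, hG.2.2, ← Nat.cast_sum, h3, Finset.sum_const,
    Finset.card_univ, nsmul_one] at h2
  have h4 := hG.2.2
  unfold genus at h4
  have h5 : 0 ≤ ∑ v, (G.weight v : ℤ) := Finset.sum_nonneg fun _ _ => by positivity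
  omega

/-- In genus one with light markings, a stable graph with a loop or a weight has one vertex: all
excesses are nonnegative and sum up to zero. -/
theorem subsingleton_of_light {G : MarkedGraph n} {w : Fin n → ℚ} (hw : ∀ i, 0 < w i)
    (hle : ∑ i, w i ≤ 1) (hG : G.InGamma 1 w) (hlw : G.HasLoopOrWeight) : Subsingleton G.V := by
  obtain ⟨u, hu⟩ := hasLoopOrWeight_iff.1 hlw
  have hnn : ∀ v, 0 ≤ G.excess v := by
    intro v
    have h := isStable_iff_excess.1 hG.2.1 v
    have h1 : ∑ i with G.mark i = v, w i ≤ ∑ i, w i :=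
      Finset.sum_le_sum_of_subset_of_nonneg (Finset.filter_subset _ _) fun i _ _ => (hw i).le
    have h2 : ((-1 : ℤ) : ℚ) < G.excess v := by
      push_cast
      linarith
    have : -1 < G.excess v := by exact_mod_cast h2
    omega
  have hsum := G.sum_excess
  rw [hG.2.2] at hsum
  have h0 := (Finset.sum_eq_zero_iff_of_nonneg fun v _ => hnn v).1 (hsum.trans (by norm_num)) u
    (Finset.mem_univ u)
  exact ⟨fun x y => (hu.eq_of_excess_eq_zero hG.1 h0 x).trans
    (hu.eq_of_excess_eq_zero hG.1 h0 y).symm⟩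

end MarkedGraph

end

end TropicalHassett

namespace TropicalHassett

/-! ### Saturation of the loop-weight locus -/

section
open scoped Classical

variable {n : ℕ}

open MarkedGraph LabelledGraph

namespace LabelledGraph

/-- Pull out a tail; its edge gets the last label. -/
noncomputable def pull {m : ℕ} (x : LabelledGraph n m) (v : x.graph.V) (l : Option x.graph.E) :
    LabelledGraph n (m + 1) where
  graph := x.graph.pull v l
  label := (Equiv.optionCongr x.label).trans finSuccEquivLast.symm

theorem pull_label_new {m : ℕ} (x : LabelledGraph n m) (v : x.graph.V) (l : Option x.graph.E) :
    (x.pull v l).label (x.graph.pullNewE v l) = Fin.last m := finSuccEquivLast_symm_none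

theorem pull_label_old {m : ℕ} (x : LabelledGraph n m) (v : x.graph.V) (l : Option x.graph.E)
    (e : x.graph.E) : (x.pull v l).label (x.graph.pullOldE v l e) = (x.label e).castSucc :=
  finSuccEquivLast_symm_some _

theorem pull_contractsTo {m : ℕ} (x : LabelledGraph n m) {v : x.graph.V}
    {l : Option x.graph.E} (h : x.graph.CanPull v l) :
    ContractsTo Fin.castSuccEmb (x.pull v l) x :=
  ⟨_, _, pull_isContraction h, fun e => x.pull_label_old v l e⟩

theorem ContractsTo.isTailEdge_iff {l m : ℕ} {ι : Fin l ↪ Fin m} {x : LabelledGraph n m}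
    {y : LabelledGraph n l} (h : ContractsTo ι x y) {w : Fin n → ℚ} (hx : x.graph.IsStable w)
    (j : Fin l) : x.graph.IsTailEdge (x.label.symm (ι j)) ↔
      y.graph.IsTailEdge (y.label.symm j) := by
  obtain ⟨f, k, hf, hk⟩ := h
  have : x.label.symm (ι j) = k (y.label.symm j) := by
    rw [Equiv.symm_apply_eq, hk, Equiv.apply_symm_apply]
  rw [← hf.isTailEdge_iff hx, this]

/-- Every stable graph is a contraction of a saturated one by tail edges: tails are pulled out
until this is no longer possible. -/
theorem exists_isSaturated {g : ℕ} {w : Fin n → ℚ} (hw : ∀ i, 0 < w i ∧ w i ≤ 1)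
    (hgw : ¬ (g = 1 ∧ ∑ i, w i ≤ 1)) {m : ℕ} (x : LabelledGraph n m)
    (hx : x.graph.InGamma g w) (hlw : x.graph.HasLoopOrWeight) :
    ∃ (m' : ℕ) (y : LabelledGraph n m') (ι : Fin m ↪ Fin m'), y.graph.InGamma g w ∧
      y.graph.HasLoopOrWeight ∧ y.graph.IsSaturated ∧ ContractsTo ι y x ∧
      ∀ j ∉ Set.range ι, y.graph.IsTailEdge (y.label.symm j) := by
  have hbound : ∀ {m : ℕ} (x : LabelledGraph n m), x.graph.InGamma g w → m ≤ 3 * g + n := by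
    intro m x hx
    have := hx.card_edges_le fun i => (hw i).2
    rwa [Fintype.card_congr x.label, Fintype.card_fin] at this
  obtain ⟨d, hd⟩ : ∃ d, m + d = 3 * g + n := ⟨_, Nat.add_sub_of_le (hbound x hx)⟩
  induction d generalizing m with
  | zero =>
    refine ⟨m, x, Function.Embedding.refl _, hx, hlw, ?_, ?_, fun j hj => absurd ⟨j, rfl⟩ hj⟩
    · intro v hv
      by_contra ht
      obtain ⟨l, hl⟩ := isLW_iff_canPull.1 hv
      have := hbound (x.pull v l) (inGamma_pull (fun i => (hw i).1) hgw hx hl ht)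
      omega
    · exact (⟨Equiv.refl _, Equiv.refl _, by simp, by simp, by simp, by simp⟩ : Iso x x).contractsTo
  | succ d ih =>
    by_cases hs : x.graph.IsSaturated
    · refine ⟨m, x, Function.Embedding.refl _, hx, hlw, hs, ?_, fun j hj => absurd ⟨j, rfl⟩ hj⟩
      exact (⟨Equiv.refl _, Equiv.refl _, by simp, by simp, by simp, by simp⟩ : Iso x x).contractsTo
    · unfold IsSaturated at hs
      push Not at hs
      obtain ⟨v, hv, ht⟩ := hs
      obtain ⟨l, hl⟩ := isLW_iff_canPull.1 hv
      obtain ⟨m', y, κ, h1, h2, h3, h4, h5⟩ := ih (x.pull v l)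
        (inGamma_pull (fun i => (hw i).1) hgw hx hl ht)
        (hasLoopOrWeight_iff.2 ⟨_, (x.graph.isTail_pull v l).1⟩) (by omega)
      refine ⟨m', y, _, h1, h2, h3, h4.trans (x.pull_contractsTo hl), fun j hj => ?_⟩
      by_cases hjκ : j ∈ Set.range κ
      · obtain ⟨i, rfl⟩ := hjκ
        rcases Fin.eq_castSucc_or_eq_last i with ⟨i, rfl⟩ | rfl
        · exact absurd ⟨i, rfl⟩ hj
        · have hlast : (x.pull v l).label.symm (Fin.last m) = x.graph.pullNewE v l :=
            (Equiv.symm_apply_eq _).2 (x.pull_label_new v l).symm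
          rw [h4.isTailEdge_iff h1.2.1, hlast]
          exact x.graph.isTailEdge_pull v l
      · exact h5 j hjκ

/-- A graph that contracts to `x` also contracts to the graph with a tail pulled out of `x`,
if the edge of the corresponding tail is among the contracted edges. -/
theorem contractsTo_pull {m m' : ℕ} {x : LabelledGraph n m} {y : LabelledGraph n m'}
    {ι : Fin m ↪ Fin m'} {f : y.graph.V → x.graph.V} {k : x.graph.E → y.graph.E}
    (h : IsContraction y.graph x.graph f k) (hk : ∀ e, y.label (k e) = ι (x.label e))
    {t u : y.graph.V} (ht : y.graph.IsTail t) {e₀ : y.graph.E}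
    (he₀ : y.graph.ends e₀ = s(u, t)) (hut : u ≠ t) (hr : e₀ ∉ Set.range k)
    {l : Option x.graph.E} (hl0 : l = none → 0 < y.graph.weight t)
    (hl : ∀ e, l = some e → y.graph.ends (k e) = s(t, t)) {j : Fin m'} (hje : y.label e₀ = j)
    (hj : j ∉ Set.range ι) : ContractsTo (Fin.Embedding.snoc ι hj) y (x.pull (f t) l) := by
  refine ⟨_, _, h.pull ht he₀ hut hr hl0 hl, fun e => ?_⟩
  rcases x.graph.pull_E_cases (f t) l e with rfl | ⟨e, rfl⟩
  · rw [pull_label_new, Fin.Embedding.snoc_last, pullElimE_new, hje]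
  · rw [pull_label_old, Fin.Embedding.snoc_castSucc, pullElimE_old, hk]

theorem notMem_range_iff {m m' : ℕ} {x : LabelledGraph n m} {y : LabelledGraph n m'}
    {ι : Fin m ↪ Fin m'} {k : x.graph.E → y.graph.E} (hk : ∀ e, y.label (k e) = ι (x.label e))
    (e : y.graph.E) : e ∉ Set.range k ↔ y.label e ∉ Set.range ι := by
  refine not_congr ⟨?_, ?_⟩
  · rintro ⟨e, rfl⟩
    exact ⟨_, (hk e).symm⟩
  · rintro ⟨i, hi⟩
    refine ⟨x.label.symm i, y.label.injective ?_⟩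
    rw [hk, Equiv.apply_symm_apply, hi]

/-- The exchange property: for every tail that is contracted on the way from one saturated graph
to `x`, a corresponding tail is contracted on the way from any other saturated graph to `x`. -/
theorem exists_common_pull {w : Fin n → ℚ} {m m₁ m₂ : ℕ} {x : LabelledGraph n m}
    {y : LabelledGraph n m₁} {z : LabelledGraph n m₂} {ι : Fin m ↪ Fin m₁} {κ : Fin m ↪ Fin m₂}
    (hy : y.graph.IsStable w) (hzs : z.graph.IsSaturated)
    (hyx : ContractsTo ι y x) (hzx : ContractsTo κ z x)
    (hι : ∀ j ∉ Set.range ι, y.graph.IsTailEdge (y.label.symm j))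
    (hκ : ∀ j ∉ Set.range κ, z.graph.IsTailEdge (z.label.symm j)) {j : Fin m₁}
    (hj : j ∉ Set.range ι) : ∃ (v : x.graph.V) (l : Option x.graph.E) (j' : Fin m₂)
      (hj' : j' ∉ Set.range κ), ContractsTo (Fin.Embedding.snoc ι hj) y (x.pull v l) ∧
        ContractsTo (Fin.Embedding.snoc κ hj') z (x.pull v l) := by
  obtain ⟨f, k, hf, hk⟩ := hyx
  obtain ⟨f', k', hf', hk'⟩ := hzx
  have hktail : ∀ e ∉ Set.range k, y.graph.IsTailEdge e := by
    intro e he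
    have := hι _ ((notMem_range_iff hk e).1 he)
    rwa [Equiv.symm_apply_apply] at this
  have hktail' : ∀ e ∉ Set.range k', z.graph.IsTailEdge e := by
    intro e he
    have := hκ _ ((notMem_range_iff hk' e).1 he)
    rwa [Equiv.symm_apply_apply] at this
  obtain ⟨u, t, he₀, hut, ht⟩ := hι j hj
  have hr : y.label.symm j ∉ Set.range k := by
    rw [notMem_range_iff hk, Equiv.apply_symm_apply]
    exact hj
  have hfu : f u = f t := hf.map_eq_of_ends hr he₀
  have hc : ¬ x.graph.IsTail (f t) := fun hc => hut (hf.eq_of_isTail hy hc hfu rfl)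
  -- A tail of `z` over `f t` was contracted, because its image is not a tail.
  have key : ∀ v, f' v = f t → z.graph.IsLW v → ∃ e u', e ∉ Set.range k' ∧ u' ≠ v ∧
      z.graph.ends e = s(u', v) ∧ z.graph.IsTail v := by
    intro v hv hlw
    have hvt := hzs v hlw
    have : ∃ v', f' v' = f' v ∧ v' ≠ v := by
      by_contra hno
      push Not at hno
      exact hc (hv ▸ (hf'.isTail_iff hno).2 hvt)
    obtain ⟨v', hv', hne⟩ := this
    obtain ⟨e, he, u', hu', h⟩ :=
      exists_edge_of_joined_ne ((hf'.fiber v v').1 hv'.symm) hne.symm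
    exact ⟨e, u', he, hu', h, hvt⟩
  have main : ∃ (l : Option x.graph.E) (v : z.graph.V), f' v = f t ∧ z.graph.IsLW v ∧
      (l = none → 0 < y.graph.weight t) ∧ (∀ e, l = some e → y.graph.ends (k e) = s(t, t)) ∧
      (l = none → 0 < z.graph.weight v) ∧ (∀ e, l = some e → z.graph.ends (k' e) = s(v, v)) := by
    rcases ht.1 with hp | ⟨e, he⟩
    · obtain ⟨v, hv, hvp⟩ := hf'.exists_weight_pos hktail' (hp.trans_le (hf.weight_le t))
      exact ⟨none, v, hv, Or.inl hvp, fun _ => hp, by simp, fun _ => hvp, by simp⟩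
    · obtain ⟨e, rfl⟩ : e ∈ Set.range k := by
        by_contra hno
        exact not_isTailEdge_of_loop he (hktail e hno)
      obtain ⟨v, hv, hve⟩ := hf'.exists_loop hktail' (e := e)
        (by rw [hf.ends, he, Sym2.map_mk])
      refine ⟨some e, v, hv, Or.inr ⟨_, hve⟩, by simp, ?_, by simp, ?_⟩
      · rintro _ ⟨⟩
        exact he
      · rintro _ ⟨⟩
        exact hve
  obtain ⟨l, v, hv, hlw, h1, h2, h3, h4⟩ := main
  obtain ⟨e, u', he, hu', hends, hvt⟩ := key v hv hlw
  refine ⟨f t, l, z.label e, (notMem_range_iff hk' e).1 he, ?_, ?_⟩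
  · exact contractsTo_pull hf hk ht he₀ hut hr h1 h2 (Equiv.apply_symm_apply _ _) hj
  · rw [← hv]
    exact contractsTo_pull hf' hk' hvt hends hu' he h3 h4 rfl _

/-- Graphs with a single vertex are determined by their genus and their number of edges. -/
theorem nonempty_iso_of_subsingleton {m : ℕ} {x y : LabelledGraph n m}
    (hx : x.graph.IsConnected) (hy : y.graph.IsConnected) [Subsingleton x.graph.V]
    [Subsingleton y.graph.V] (hg : x.graph.genus = y.graph.genus) : Nonempty (Iso x y) := by
  obtain ⟨a⟩ := hx.1
  obtain ⟨b⟩ := hy.1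
  have huniv : ∀ {G : MarkedGraph n} [Subsingleton G.V] (a : G.V), G.genus =
      (Fintype.card G.E : ℤ) + G.weight a := by
    intro G _ a
    have : Fintype.card G.V = 1 := Fintype.card_eq_one_iff.2 ⟨a, fun _ => Subsingleton.elim _ _⟩
    rw [genus, this, Fintype.sum_subsingleton _ a]
    push_cast
    ring
  have hw : y.graph.weight b = x.graph.weight a := by
    rw [huniv a, huniv b, Fintype.card_congr x.label, Fintype.card_congr y.label] at hg
    omega
  refine ⟨⟨⟨fun _ => b, fun _ => a, fun _ => Subsingleton.elim _ _,
    fun _ => Subsingleton.elim _ _⟩, x.label.trans y.label.symm, fun e => ?_,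
    fun i => Subsingleton.elim _ _, fun v => ?_, fun e => by simp⟩⟩
  · exact Subsingleton.elim _ _
  · rw [Subsingleton.elim v a]
    exact hw

/-- The graph with one vertex of weight `h` and with `m` loops. -/
def bouquet (n m h : ℕ) : LabelledGraph n m where
  graph :=
    { V := Unit
      E := Fin m
      ends := fun _ => s((), ())
      mark := fun _ => ()
      weight := fun _ => h }
  label := Equiv.refl _

theorem bouquet_inGamma {m h g : ℕ} (hg : m + h = g) (hg1 : 1 ≤ g) (hn : 1 ≤ n) {w : Fin n → ℚ}
    (hw : ∀ i, 0 < w i) : (bouquet n m h).graph.InGamma g w := by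
  have hval : ∀ v, (bouquet n m h).graph.val v = m * 2 := by
    intro v
    rw [val_eq_sum, Finset.sum_congr rfl fun e _ => incidence_loop (rfl : _ = s(v, v)),
      Finset.sum_const, Finset.card_univ, Fintype.card_congr (bouquet n m h).label,
      Fintype.card_fin, smul_eq_mul]
  refine ⟨⟨⟨()⟩, fun u v => Setoid.refl' _ _⟩, fun v => ?_, ?_⟩
  · have : Nonempty (Fin n) := ⟨⟨0, hn⟩⟩
    have h1 : 0 < ∑ i with (bouquet n m h).graph.mark i = v, w i :=
      Finset.sum_pos (fun i _ => hw i)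
        ⟨⟨0, hn⟩, Finset.mem_filter.2 ⟨Finset.mem_univ _, rfl⟩⟩
    have h2 : (1 : ℚ) ≤ m + h := by exact_mod_cast hg ▸ hg1
    rw [hval]
    change 0 < 2 * (h : ℚ) - 2 + ((m * 2 : ℕ) : ℚ) + _
    push_cast
    linarith
  · change ((Fintype.card (Fin m) : ℤ) - Fintype.card Unit + 1) + ∑ v : Unit, (h : ℤ) = g
    simp
    omega

end LabelledGraph

/-- The simplex of the loop-weight locus that is given by an edge-labelled graph. -/
def simplexOf {g : ℕ} {w : Fin n → ℚ} {m : ℕ} (x : LabelledGraph n m)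
    (hx : x.graph.InGamma g w) (hlw : x.graph.HasLoopOrWeight) :
    Simp (loopWeightLocus g w).toFunctor m :=
  ⟨Quotient.mk (isoSetoid g w m) ⟨x, hx⟩, ⟨x, hx⟩, rfl, hlw⟩

section Simplices

variable {g : ℕ} {w : Fin n → ℚ}

theorem exists_simplexOf_eq {m : ℕ} (s : Simp (loopWeightLocus g w).toFunctor m) :
    ∃ (x : LabelledGraph n m) (hx : x.graph.InGamma g w) (hlw : x.graph.HasLoopOrWeight),
      simplexOf x hx hlw = s := by
  obtain ⟨_, ⟨x, hx⟩, rfl, hlw⟩ := s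
  exact ⟨x, hx, hlw, rfl⟩

theorem simplexOf_eq_iff {m : ℕ} {x y : LabelledGraph n m} {hx : x.graph.InGamma g w}
    {hy : y.graph.InGamma g w} {hlx : x.graph.HasLoopOrWeight} {hly : y.graph.HasLoopOrWeight} :
    simplexOf x hx hlx = simplexOf y hy hly ↔ Nonempty (Iso x y) := by
  refine Subtype.ext_iff.trans ?_
  exact Quotient.eq (r := isoSetoid g w m)

theorem face_simplexOf_eq_iff {l m : ℕ} {ι : Fin l ↪ Fin m} {x : LabelledGraph n m}
    {y : LabelledGraph n l} {hx : x.graph.InGamma g w}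
    {hy : y.graph.InGamma g w} {hlx : x.graph.HasLoopOrWeight} {hly : y.graph.HasLoopOrWeight} :
    face ι (simplexOf x hx hlx) = simplexOf y hy hly ↔ ContractsTo ι x y := by
  have h : face ι (simplexOf x hx hlx) = simplexOf (x.restrict ι)
      ((contract_isContraction _ _).inGamma hx) (hasLoopOrWeight_contract _ _ hlx) := rfl
  rw [h]
  refine simplexOf_eq_iff.trans ?_
  constructor
  · rintro ⟨φ⟩
    exact (contractsTo_restrict x ι).trans φ.contractsTo
  · exact fun h => (contractsTo_restrict x ι).unique h

/-- The labels of the edges that are not attached to tails. -/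
noncomputable def coreLabels {m : ℕ} (s : Simp (loopWeightLocus g w).toFunctor m) :
    Finset (Fin m) :=
  {j | ∃ (x : LabelledGraph n m) (hx : x.graph.InGamma g w) (hlw : x.graph.HasLoopOrWeight),
    simplexOf x hx hlw = s ∧ ¬ x.graph.IsTailEdge (x.label.symm j)}

theorem mem_coreLabels_simplexOf {m : ℕ} {x : LabelledGraph n m} {hx : x.graph.InGamma g w}
    {hlw : x.graph.HasLoopOrWeight} {j : Fin m} :
    j ∈ coreLabels (simplexOf x hx hlw) ↔ ¬ x.graph.IsTailEdge (x.label.symm j) := by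
  rw [coreLabels, Finset.mem_filter]
  constructor
  · rintro ⟨-, y, hy, hly, hyx, hj⟩
    obtain ⟨φ⟩ := simplexOf_eq_iff.1 hyx
    rwa [← φ.contractsTo.isTailEdge_iff hy.2.1 j]
  · exact fun h => ⟨Finset.mem_univ _, x, hx, hlw, rfl, h⟩

/-- The tail edges and the saturated graphs form a saturation of the loop-weight locus, unless
the genus is one and the markings are too light. -/
noncomputable def tailSaturation (hn : 1 ≤ n) (hw : ∀ i, 0 < w i ∧ w i ≤ 1)
    (hgw : ¬ (g = 1 ∧ ∑ i, w i ≤ 1)) : Saturation (loopWeightLocus g w).toFunctor where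
  core := coreLabels
  mem_core_face {k m} ι s j := by
    obtain ⟨x, hx, hlw, rfl⟩ := exists_simplexOf_eq s
    obtain ⟨y, hy, hly, hyx⟩ := exists_simplexOf_eq (face ι (simplexOf x hx hlw))
    rw [← hyx, mem_coreLabels_simplexOf, mem_coreLabels_simplexOf,
      (face_simplexOf_eq_iff.1 hyx.symm).isTailEdge_iff hx.2.1]
  Sat {m} s := ∃ (x : LabelledGraph n m) (hx : x.graph.InGamma g w)
    (hlw : x.graph.HasLoopOrWeight), simplexOf x hx hlw = s ∧ x.graph.IsSaturated
  exists_sat {m} s := by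
    obtain ⟨x, hx, hlw, rfl⟩ := exists_simplexOf_eq s
    obtain ⟨m', y, ι, h1, h2, h3, h4, h5⟩ := exists_isSaturated hw hgw x hx hlw
    refine ⟨m', simplexOf y h1 h2, ι, ⟨y, h1, h2, rfl, h3⟩, face_simplexOf_eq_iff.2 h4, ?_⟩
    intro j hj
    rw [mem_coreLabels_simplexOf, not_not]
    exact h5 j hj
  exchange {m m₁ m₂ s s' ι ι'} := by
    rintro ⟨y, hy, hly, rfl, -⟩ ⟨z, hz, hlz, rfl, hzs⟩ hι hκ hface j hj
    obtain ⟨x, hx, hlx, hxy⟩ := exists_simplexOf_eq (face ι (simplexOf y hy hly))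
    simp only [mem_coreLabels_simplexOf, not_not] at hι hκ
    obtain ⟨v, l, j', hj', h1, h2⟩ := exists_common_pull hy.2.1 hzs
      (face_simplexOf_eq_iff.1 hxy.symm) (face_simplexOf_eq_iff.1 (hxy.trans hface).symm) hι hκ hj
    obtain ⟨_, _, h, -⟩ := id h1
    have hlw : (x.pull v l).graph.HasLoopOrWeight :=
      hasLoopOrWeight_iff.2 ⟨_, (x.graph.isTail_pull v l).1⟩
    have hG := h.inGamma hy
    refine ⟨j', hj', (?_ : _ = simplexOf (x.pull v l) hG hlw).trans ?_⟩
    · exact face_simplexOf_eq_iff.2 h1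
    · exact (face_simplexOf_eq_iff.2 h2).symm
  exists_notMem_core {m s} := by
    rintro ⟨x, hx, hlw, rfl, hs⟩
    obtain ⟨t, ht⟩ := hasLoopOrWeight_iff.1 hlw
    have ht' := hs t ht
    -- A marking gives a second vertex, so that an edge leaves the tail.
    obtain ⟨e, -, u, hu, he⟩ := exists_edge_of_joined_ne
      (hx.1.2 t (x.graph.mark ⟨0, hn⟩)) (ht'.2.1 _).symm
    refine ⟨x.label e, ?_⟩
    rw [mem_coreLabels_simplexOf, not_not, Equiv.symm_apply_apply]
    exact ⟨u, t, he, hu, ht'⟩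

theorem subsingleton_simp_of_subsingleton {m : ℕ}
    (h : ∀ x : LabelledGraph n m, x.graph.InGamma g w → x.graph.HasLoopOrWeight →
      Subsingleton x.graph.V) : Subsingleton (Simp (loopWeightLocus g w).toFunctor m) := by
  refine ⟨fun s s' => ?_⟩
  obtain ⟨x, hx, hlx, rfl⟩ := exists_simplexOf_eq s
  obtain ⟨y, hy, hly, rfl⟩ := exists_simplexOf_eq s'
  have := h x hx hlx
  have := h y hy hly
  exact simplexOf_eq_iff.2 (nonempty_iso_of_subsingleton hx.1 hy.1 (hx.2.2.trans hy.2.2.symm))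

end Simplices

end

end TropicalHassett

open TropicalHassett MarkedGraph LabelledGraph in
theorem mainTheorem7 (g n : ℕ) (hg : 1 ≤ g) (hn : 1 ≤ n) (w : Fin n → ℚ)
    (hw : ∀ i, 0 < w i ∧ w i ≤ 1) :
    ContractibleSpace
      (TropicalHassett.Realization (TropicalHassett.loopWeightLocus g w).toFunctor) := by
  by_cases hgw : g = 1 ∧ ∑ i, w i ≤ 1
  · -- The locus is a single point, given by the graph with one vertex and one loop.
    obtain ⟨rfl, hle⟩ := hgw
    have hsub : ∀ {m : ℕ} (x : LabelledGraph n m), x.graph.InGamma 1 w →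
        x.graph.HasLoopOrWeight → Subsingleton x.graph.V :=
      fun x hx hlx => subsingleton_of_light (fun i => (hw i).1) hle hx hlx
    have : Subsingleton (Simp (loopWeightLocus 1 w).toFunctor 1) :=
      subsingleton_simp_of_subsingleton hsub
    have : Nonempty (Simp (loopWeightLocus 1 w).toFunctor 1) :=
      ⟨simplexOf (bouquet n 1 0) (bouquet_inGamma rfl le_rfl hn fun i => (hw i).1)
        (Or.inl ⟨(0 : Fin 1), Sym2.mk_isDiag_iff.2 rfl⟩)⟩
    refine contractibleSpace_of_point fun m s => ?_
    obtain ⟨x, hx, hlx, rfl⟩ := exists_simplexOf_eq s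
    have := hsub x hx hlx
    have h1 : Fintype.card x.graph.V ≤ 1 := Fintype.card_le_one_iff_subsingleton.2 this
    have h2 := hx.2.2
    have h3 : 0 ≤ ∑ v, (x.graph.weight v : ℤ) := Finset.sum_nonneg fun _ _ => by positivity
    rw [genus, Fintype.card_congr x.label, Fintype.card_fin] at h2
    omega
  · have : Nonempty (Simp (loopWeightLocus g w).toFunctor 0) :=
      ⟨simplexOf (bouquet n 0 g) (bouquet_inGamma (by simp) hg hn fun i => (hw i).1)
        (Or.inr ⟨(), hg⟩)⟩
    have : Subsingleton (Simp (loopWeightLocus g w).toFunctor 0) := by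
      refine subsingleton_simp_of_subsingleton fun x hx _ => ⟨fun u v => ?_⟩
      by_contra hne
      obtain ⟨e, -⟩ := exists_edge_of_joined_ne (hx.1.2 u v) hne
      exact (x.label e).elim0
    refine (tailSaturation hn hw hgw).contractibleSpace (B := 3 * g + n) fun m s => ?_
    obtain ⟨x, hx, -, rfl⟩ := exists_simplexOf_eq s
    have := hx.card_edges_le fun i => (hw i).2
    rwa [Fintype.card_congr x.label, Fintype.card_fin] at this
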